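/- Let $V$ be a finite set of $n\ge 2$ nodes. Node $j$ has a cost $f_j(x)=\tfrac12\alpha_j(x-\rho_j)^2$ with $\alpha_j>0$, where $z_j^0:=\alpha_j$ and $y_j^0:=\alpha_j\rho_j$ are integers. Let $$x^*=\frac{\sum_j\alpha_j\rho_j}{\sum_j\alpha_j}.$$ The nodes communicate over a digraph on $V$ without self-loops that is strongly connected. An edge from $i$ to $j$ means that $i$ can transmit to $j$; $\mathcal D_j^+$ is the out-degree of $j$ and $\mathcal D^+_{\max}=\max_j\mathcal D_j^+$. All nodes know a number $D$ that is equal to, or an upper bound on, the diameter. **Algorithm.** Initially $y_j=2y_j^0$, $z_j=2z_j^0$, $\mathrm{flag}_j=0$. At each iteration $k=1,2,\dots$ every node $j$ with $\mathrm{flag}_j=0$ does the following, synchronously; a node with $\mathrm{flag}_j=1$ does nothing any more. 1. If $k\equiv1\pmod D$, it sets $M_j=\lceil y_j/z_j\rceil$ and $m_j=\lfloor y_j/z_j\rfloor$. It broadcasts $M_j,m_j$ to its out-neighbours and replaces $M_j$ by the maximum and $m_j$ by the minimum of its own value and the values received from its in-neighbours. 2. If $z_j>1$, it sets $q_j=\lceil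 y_j/z_j\rceil$ and splits $y_j$ into $z_j$ integer pieces of values $\lfloor y_j/z_j\rfloor$ and $\lfloor y_j/z_j\rfloor+1$ with sum $y_j$. It keeps one piece of minimal value and sends each of the other $z_j-1$ pieces to a node chosen uniformly among the $1+\mathcal D_j^+$ nodes consisting of itself and its out-neighbours. All these choices, over all pieces, nodes and iterations, are independent. If $z_j\le1$, it keeps everything. 3. Its new $y_j$ is the sum of the values, and its new $z_j$ the number, of the pieces that it kept or received. 4. If $k\equiv0\pmod D$ and $M_j-m_j\le1$, it sets $q_j=m_j$ (its computed value) and $\mathrm{flag}_j=1$ (it terminates). **Theorem.** The number $x^*$ is the unique minimizer over $\mathbb Q$ of $\sum_j f_j(x)$. There is a natural number $N$, which depends only on the initial values $(y_j^0,z_j^0)_{j\in V}$, such that for every digraph, every $D$ and every family of independent choices as above: (i) Almost surely there is a finite step $K$ at which all nodes terminate simultaneously: no flag is raised before $K$; at step $K$ every node $j$ has $\mathrm{flag}_j=1$ and $q_j=\lfloor x^*\rfloor$, so that $|q_j-x^*|<1$ (the quantization level), with $q_j=x^*$ if $x^*$ is an integer; and nothing changes after step $K$. (ii) For all $0<\varepsilon<1$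 and all integers $$\tau\ge\left\lceil\frac{\log\varepsilon}{\log\bigl(1-(1+\mathcal D^+_{\max})^{-D}\bigr)}\right\rceil,$$ with probability at least $(1-\varepsilon)^N$ all nodes have terminated with $q_j=\lfloor x^*\rfloor$ after at most $\left\lceil N\tau D/D\right\rceil D+D=N\tau D+D$ steps. -/

import Mathlib

open MeasureTheory ProbabilityTheory

noncomputable section

namespace QuantizedOpt

/-! ### The optimization problem -/

/-- The global cost `∑ i, (1/2) α i (x - ρ i)^2` of a common decision `x`. -/
def globalCost {V : Type*} [Fintype V] (α ρ : V → ℚ) (x : ℚ) : ℚ :=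
  ∑ i, (1 / 2) * α i * (x - ρ i) ^ 2

/-- The closed form `(∑ i, α i ρ i) / (∑ i, α i)` of the optimum. -/
def xStar {V : Type*} [Fintype V] (α ρ : V → ℚ) : ℚ :=
  (∑ i, α i * ρ i) / ∑ i, α i

/-! ### Digraphs

`G.Adj i j` means that there is an edge from `i` to `j`: node `i` can transmit to node `j`. -/

/-- There is a directed path of length `t` from `i` to `j`. -/
def HasPath {V : Type*} (G : Digraph V) (t : ℕ) (i j : V) : Prop :=
  ∃ p : ℕ → V, p 0 = i ∧ p t = j ∧ ∀ s < t, G.Adj (p s) (p (s + 1))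

/-- Every node can be reached from every other node along a directed path. -/
def StronglyConnected {V : Type*} (G : Digraph V) : Prop :=
  ∀ i j : V, i ≠ j → ∃ t : ℕ, HasPath G t i j

/-- The length of a shortest directed path from `i` to `j`. -/
def pathDist {V : Type*} (G : Digraph V) (i j : V) : ℕ :=
  sInf {t : ℕ | HasPath G t i j}

/-- The diameter: the longest shortest path between any two nodes. -/
def diameter {V : Type*} [Fintype V] (G : Digraph V) : ℕ :=
  Finset.univ.sup fun e : V × V => pathDist G e.1 e.2

open Classical in
/-- The number of out-neighbours of `j`. -/
def outDegree {V : Type*} [Fintype V] (G : Digraph V) (j : V) : ℕ :=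
  (Finset.univ.filter fun l => G.Adj j l).card

/-- The maximal out-degree. -/
def maxOutDegree {V : Type*} [Fintype V] (G : Digraph V) : ℕ :=
  Finset.univ.sup fun j => outDegree G j

/-! ### The synchronous quantized algorithm -/

open Classical in
/-- The probability with which node `j` selects `l` as the target of a piece. -/
def transmitProb {V : Type*} [Fintype V] (G : Digraph V) (l j : V) : ℝ :=
  if l = j ∨ G.Adj j l then 1 / (1 + (outDegree G j : ℝ)) else 0

/-- The values stored at the nodes: the masses `y`, `z`, the variables `M`, `m` of the max- and
min-consensus, the state `qs` (the node's current estimate of the optimum, which is its output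
once it has terminated), and the termination flag. -/
structure State (V : Type*) where
  y : V → ℤ
  z : V → ℤ
  M : V → ℤ
  m : V → ℤ
  qs : V → ℤ
  flag : V → Bool

/-- Initialization: the initial values are doubled and the flags are lowered. The entries of `M`,
`m` and `qs` are placeholders, which are overwritten in the first iteration. -/
def initState {V : Type*} (y₀ z₀ : V → ℤ) : State V where
  y := fun j => 2 * y₀ j
  z := fun j => 2 * z₀ j
  M := fun _ => 0
  m := fun _ => 0
  qs := fun _ => 0
  flag := fun _ => false

/-- `y` is split into `z` integer pieces with values `⌊y / z⌋` and `⌊y / z⌋ + 1`, the larger pieces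
first. This is the value of the piece with number `i`, where `0 ≤ i < z`; the last piece, with
number `z - 1`, is a minimal one and has value `⌊y / z⌋`. -/
def pieceValue (y z : ℤ) (i : ℕ) : ℤ :=
  let δ : ℤ := ⌊(y : ℚ) / (z : ℚ)⌋
  let r : ℤ := y - δ * z
  δ + if (i : ℤ) < r then 1 else 0

/-- The `y`-mass that a node with masses `y`, `z` does not hand out: the last, minimal piece if
`z > 1`, and everything otherwise. -/
def keptY (y z : ℤ) : ℤ :=
  if 1 < z then pieceValue y z (z - 1).toNat else y

/-- The `z`-mass that a node with `z`-mass `z` does not hand out. -/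
def keptZ (z : ℤ) : ℤ :=
  if 1 < z then 1 else z

open Classical in
/-- The `y`-mass that a node with masses `y`, `z` hands out to `l`, when its `i`-th piece goes to
`choice i`. There are `z - 1` pieces to hand out if `z > 1`, and none otherwise. -/
def sentY {V : Type*} (y z : ℤ) (choice : ℕ → V) (l : V) : ℤ :=
  ∑ i ∈ Finset.range (z - 1).toNat, if choice i = l then pieceValue y z i else 0

open Classical in
/-- The `z`-mass that a node with `z`-mass `z` hands out to `l`. -/
def sentZ {V : Type*} (z : ℤ) (choice : ℕ → V) (l : V) : ℤ :=
  ∑ i ∈ Finset.range (z - 1).toNat, if choice i = l then 1 else 0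

open Classical in
/-- The nodes from which `j` receives consensus values: itself and those of its in-neighbours
that have not terminated. -/
def senders {V : Type*} [Fintype V] (G : Digraph V) (s : State V) (j : V) : Finset V :=
  Finset.univ.filter fun i => i = j ∨ (G.Adj i j ∧ s.flag i = false)

theorem senders_nonempty {V : Type*} [Fintype V] (G : Digraph V) (s : State V) (j : V) :
    (senders G s j).Nonempty :=
  ⟨j, by simp [senders]⟩

/-- The value of `M` that node `j` broadcasts at iteration `k`: every `D` steps it is reset. -/
def broadcastMax {V : Type*} (D k : ℕ) (s : State V) (j : V) : ℤ :=
  if k ≡ 1 [MOD D] then ⌈(s.y j : ℚ) / (s.z j : ℚ)⌉ else s.M j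

/-- The value of `m` that node `j` broadcasts at iteration `k`: every `D` steps it is reset. -/
def broadcastMin {V : Type*} (D k : ℕ) (s : State V) (j : V) : ℤ :=
  if k ≡ 1 [MOD D] then ⌊(s.y j : ℚ) / (s.z j : ℚ)⌋ else s.m j

/-- The value of `M` at node `j` after the exchange of iteration `k`. -/
def newMax {V : Type*} [Fintype V] (G : Digraph V) (D k : ℕ) (s : State V) (j : V) : ℤ :=
  (senders G s j).sup' (senders_nonempty G s j) (broadcastMax D k s)

/-- The value of `m` at node `j` after the exchange of iteration `k`. -/
def newMin {V : Type*} [Fintype V] (G : Digraph V) (D k : ℕ) (s : State V) (j : V) : ℤ :=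
  (senders G s j).inf' (senders_nonempty G s j) (broadcastMin D k s)

/-- The stopping test of node `j` at iteration `k`. -/
def Stops {V : Type*} [Fintype V] (G : Digraph V) (D k : ℕ) (s : State V) (j : V) : Prop :=
  k ≡ 0 [MOD D] ∧ newMax G D k s j - newMin G D k s j ≤ 1

open Classical in
/-- Iteration `k` of the algorithm, when node `j` chooses `choice j i` as the target of its `i`-th
piece. A node whose flag is raised no longer does anything. -/
def step {V : Type*} [Fintype V] (G : Digraph V) (D k : ℕ) (choice : V → ℕ → V) (s : State V) :
    State V where
  y := fun j => if s.flag j then s.y j else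
    keptY (s.y j) (s.z j) +
      ∑ i, if s.flag i then 0 else sentY (s.y i) (s.z i) (choice i) j
  z := fun j => if s.flag j then s.z j else
    keptZ (s.z j) + ∑ i, if s.flag i then 0 else sentZ (s.z i) (choice i) j
  M := fun j => if s.flag j then s.M j else newMax G D k s j
  m := fun j => if s.flag j then s.m j else newMin G D k s j
  qs := fun j => if s.flag j then s.qs j else
    if Stops G D k s j then newMin G D k s j else
      if 1 < s.z j then ⌈(s.y j : ℚ) / (s.z j : ℚ)⌉ else s.qs j
  flag := fun j => s.flag j || decide (Stops G D k s j)

/-- The state after the iterations `1, …, k`, when `X k j i` is the target of the `i`-th piece that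
node `j` hands out at iteration `k`. -/
def run {V : Type*} [Fintype V] (G : Digraph V) (D : ℕ) (y₀ z₀ : V → ℤ) (X : ℕ → V → ℕ → V) :
    ℕ → State V
  | 0 => initState y₀ z₀
  | k + 1 => step G D (k + 1) (X (k + 1)) (run G D y₀ z₀ X k)

/-- The random choices of the nodes: `X k j i` is the target of the `i`-th piece that node `j` hands
out at iteration `k`. All choices are independent, and node `j` chooses `l` with probability
`transmitProb G l j`. -/
structure IsRandomChoice {V : Type*} [Fintype V] (G : Digraph V) {Ω : Type*} [MeasurableSpace Ω]
    (μ : Measure Ω) (X : ℕ → V → ℕ → Ω → V) : Prop where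
  measurable : ∀ k j i, Measurable[_, ⊤] (X k j i)
  indep : iIndepFun (β := fun _ : ℕ × V × ℕ => V) (m := fun _ => ⊤)
    (fun t => X t.1 t.2.1 t.2.2) μ
  law : ∀ k j i l, μ {ω | X k j i ω = l} = ENNReal.ofReal (transmitProb G l j)

end QuantizedOpt

end

/-! Regard the masses as integer pieces held by the nodes. An iteration moves pieces, and each node
re-splits what it holds as evenly as possible. Number and sum of the pieces are conserved, and even
splitting minimizes the sum of squares, so the `energy` never grows; `energy_massStep_add` gives the
exact loss. If nothing is lost, each node received only two consecutive values f and f + 1, where f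
is its new kept value, so kept values can only fall. The integer `rank` combines both effects
lexicographically: it is nonnegative, never increases, and starts at a value determined by the
initial data alone.

If the rank does not change, pieces merely travel: a piece of value v sent to a node is matched
there by a piece of value v that will be handed out (`exists_pieceValue_massStep`). As long as the
masses are not `Balanced`, some piece to be handed out is incompatible with the kept piece of some
node t (`exists_piece_of_not_balanced`); this needs more pieces than nodes, which the initial
doubling guarantees. Such a piece cannot reach t without a drop of the rank. It follows a path of
length at most D with probability at least `minProb G ^ D`, so τ windows of D iterations all fail
with probability at most `(1 - minProb G ^ D) ^ τ`. After N successful phases, N exceeding the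
initial rank, only balance is left, and balance persists. Letting τ tend to infinity gives almost
sure balance.

Over a window, max- and min-consensus compute the exact extremes of the rounded quotients at its
start. All nodes therefore evaluate the same test, namely balance at the start of the window, and
stop together (`stops_iff_balanced`). The common minimum is then the floor of the conserved ratio
(`eq_floor_of_balanced`). -/

noncomputable section

namespace QuantizedOpt

/-! ### Integer pieces, their energy and rank -/

section Masses

/-- The quotient `⌊y / z⌋`, the value of a minimal piece. -/
def quo (y z : ℤ) : ℤ := ⌊(y : ℚ) / (z : ℚ)⌋

theorem le_quo_iff {y z a : ℤ} (hz : 0 < z) : a ≤ quo y z ↔ a * z ≤ y := by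
  have : (0 : ℚ) < z := by exact_mod_cast hz
  rw [quo, Int.le_floor, le_div_iff₀ this]
  exact_mod_cast Iff.rfl

theorem ceil_div_le_iff {y z a : ℤ} (hz : 0 < z) : ⌈(y : ℚ) / (z : ℚ)⌉ ≤ a ↔ y ≤ a * z := by
  have : (0 : ℚ) < z := by exact_mod_cast hz
  rw [Int.ceil_le, div_le_iff₀ this]
  exact_mod_cast Iff.rfl

theorem quo_mul_le {y z : ℤ} (hz : 0 < z) : quo y z * z ≤ y := (le_quo_iff hz).1 le_rfl

theorem lt_quo_add_one_mul {y z : ℤ} (hz : 0 < z) : y < (quo y z + 1) * z := by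
  by_contra h
  have := (le_quo_iff hz).2 (not_lt.1 h)
  omega

theorem quo_le_ceil (y z : ℤ) : quo y z ≤ ⌈(y : ℚ) / (z : ℚ)⌉ := Int.floor_le_ceil _

theorem ceil_le_quo_add_one (y z : ℤ) : ⌈(y : ℚ) / (z : ℚ)⌉ ≤ quo y z + 1 :=
  Int.ceil_le_floor_add_one _

theorem pieceValue_eq (y z : ℤ) (i : ℕ) :
    pieceValue y z i = quo y z + if (i : ℤ) < y - quo y z * z then 1 else 0 := rfl

theorem quo_le_pieceValue (y z : ℤ) (i : ℕ) : quo y z ≤ pieceValue y z i := by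
  rw [pieceValue_eq]; split_ifs <;> omega

theorem pieceValue_le_ceil {y z : ℤ} (hz : 0 < z) (i : ℕ) :
    pieceValue y z i ≤ ⌈(y : ℚ) / (z : ℚ)⌉ := by
  rw [pieceValue_eq]
  split_ifs with h
  · by_contra! h'
    have := (ceil_div_le_iff (y := y) (a := quo y z) hz).1 (by omega)
    omega
  · simpa using quo_le_ceil y z

theorem pieceValue_eq_or (y z : ℤ) (i : ℕ) :
    pieceValue y z i = quo y z ∨ pieceValue y z i = quo y z + 1 := by
  rw [pieceValue_eq]; split_ifs <;> omega

/-- The remainder is less than z and larger pieces come first, so the last piece is minimal; for z =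
1 the whole mass is that piece. Both branches thus count as one kept piece. -/
theorem keptY_eq {y z : ℤ} (hz : 0 < z) : keptY y z = quo y z := by
  have h1 := quo_mul_le (y := y) hz
  have h2 := lt_quo_add_one_mul (y := y) hz
  unfold keptY
  split_ifs with h
  · rw [pieceValue_eq, if_neg, add_zero]
    rw [Int.toNat_of_nonneg (by omega)]
    nlinarith
  · obtain rfl : z = 1 := by omega
    omega

theorem keptZ_eq {z : ℤ} (hz : 0 < z) : keptZ z = 1 := by
  unfold keptZ; split_ifs <;> omega

/-- The sum of `g` over the values of all pieces of a node with masses `y` and `z`. -/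
def piecesSum (g : ℤ → ℤ) (y z : ℤ) : ℤ :=
  g (quo y z) + ∑ i ∈ Finset.range (z - 1).toNat, g (pieceValue y z i)

theorem sum_range_ite_lt (n : ℕ) (r : ℤ) (h0 : 0 ≤ r) (hr : r ≤ n) :
    ∑ i ∈ Finset.range n, (if (i : ℤ) < r then (1 : ℤ) else 0) = r := by
  lift r to ℕ using h0
  rw [← Finset.sum_filter, Finset.sum_const]
  have : (Finset.range n).filter (fun i : ℕ => (i : ℤ) < r) = Finset.range r := by
    ext i; simp; omega
  rw [this]; simp

theorem piecesSum_id {y z : ℤ} (hz : 0 < z) : piecesSum (fun v => v) y z = y := by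
  have h1 := quo_mul_le (y := y) hz
  have h2 := lt_quo_add_one_mul (y := y) hz
  have h3 : ((z - 1).toNat : ℤ) = z - 1 := Int.toNat_of_nonneg (by omega)
  unfold piecesSum
  simp only [pieceValue_eq, Finset.sum_add_distrib, Finset.sum_const, Finset.card_range]
  rw [sum_range_ite_lt _ _ (by omega) (by rw [h3]; nlinarith), nsmul_eq_mul, h3]
  ring

theorem piecesSum_one {y z : ℤ} (hz : 0 < z) : piecesSum (fun _ => 1) y z = z := by
  have h3 : ((z - 1).toNat : ℤ) = z - 1 := Int.toNat_of_nonneg (by omega)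
  rw [piecesSum, Finset.sum_const, Finset.card_range, nsmul_eq_mul, h3]; ring

/-- On the two values f and f + 1 the square is an affine function, so the sum of squares is
determined by the sum and the number of the pieces. -/
theorem piecesSum_sq {y z : ℤ} (hz : 0 < z) :
    piecesSum (fun v => v ^ 2) y z
      = (2 * quo y z + 1) * y - quo y z * (quo y z + 1) * z := by
  set f := quo y z with hf
  have h0 : ∀ i, pieceValue y z i ^ 2
      = (2 * f + 1) * pieceValue y z i - f * (f + 1) * 1 := by
    intro i
    rcases pieceValue_eq_or y z i with h | h <;> rw [h, ← hf] <;> ring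
  have : piecesSum (fun v => v ^ 2) y z = (2 * f + 1) * piecesSum (fun v => v) y z
      - f * (f + 1) * piecesSum (fun _ => 1) y z := by
    unfold piecesSum
    simp only [h0, ← hf, Finset.sum_sub_distrib, ← Finset.mul_sum]
    ring
  rw [this, piecesSum_id hz, piecesSum_one hz]

variable {V : Type*} [Fintype V]

/-- The masses `(y, z)` of all nodes after one exchange among nodes that are all active. -/
def massStep (c : V → ℕ → V) (s : (V → ℤ) × (V → ℤ)) : (V → ℤ) × (V → ℤ) :=
  (fun j => keptY (s.1 j) (s.2 j) + ∑ i, sentY (s.1 i) (s.2 i) (c i) j,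
   fun j => keptZ (s.2 j) + ∑ i, sentZ (s.2 i) (c i) j)

/-- The value of the piece that node `j` keeps. -/
def kept (s : (V → ℤ) × (V → ℤ)) (j : V) : ℤ := quo (s.1 j) (s.2 j)

open Classical in
/-- The sum of `g` over the values of the pieces that node `j` holds after the exchange. -/
def receivedSum (c : V → ℕ → V) (s : (V → ℤ) × (V → ℤ)) (g : ℤ → ℤ) (j : V) : ℤ :=
  g (kept s j) + ∑ i, ∑ a ∈ Finset.range (s.2 i - 1).toNat,
    if c i a = j then g (pieceValue (s.1 i) (s.2 i) a) else 0

theorem receivedSum_linear (c : V → ℕ → V) (s : (V → ℤ) × (V → ℤ)) (g h : ℤ → ℤ) (a b : ℤ)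
    (j : V) : receivedSum c s (fun v => a * g v + b * h v) j
      = a * receivedSum c s g j + b * receivedSum c s h j := by
  classical
  have : ∀ i k, (if c i k = j then a * g (pieceValue (s.1 i) (s.2 i) k)
        + b * h (pieceValue (s.1 i) (s.2 i) k) else 0)
      = a * (if c i k = j then g (pieceValue (s.1 i) (s.2 i) k) else 0)
        + b * (if c i k = j then h (pieceValue (s.1 i) (s.2 i) k) else 0) := by
    intro i k; split_ifs <;> ring
  simp only [receivedSum, this, Finset.sum_add_distrib, ← Finset.mul_sum]
  ring

theorem sum_receivedSum (c : V → ℕ → V) (s : (V → ℤ) × (V → ℤ)) (g : ℤ → ℤ) :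
    ∑ j, receivedSum c s g j = ∑ i, piecesSum g (s.1 i) (s.2 i) := by
  classical
  simp only [receivedSum, piecesSum, Finset.sum_add_distrib]
  congr 1
  rw [Finset.sum_comm]
  refine Finset.sum_congr rfl fun i _ => ?_
  rw [Finset.sum_comm]
  simp

theorem massStep_fst (c : V → ℕ → V) {s : (V → ℤ) × (V → ℤ)} (hs : ∀ j, 0 < s.2 j) (j : V) :
    (massStep c s).1 j = receivedSum c s (fun v => v) j := by
  simp [massStep, receivedSum, keptY_eq (hs j), sentY, kept]

theorem massStep_snd (c : V → ℕ → V) {s : (V → ℤ) × (V → ℤ)} (hs : ∀ j, 0 < s.2 j) (j : V) :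
    (massStep c s).2 j = receivedSum c s (fun _ => 1) j := by
  simp [massStep, receivedSum, keptZ_eq (hs j), sentZ]

theorem kept_le_receivedSum (c : V → ℕ → V) (s : (V → ℤ) × (V → ℤ)) {g : ℤ → ℤ} {j : V}
    (hg : ∀ i, ∀ a < (s.2 i - 1).toNat, c i a = j → 0 ≤ g (pieceValue (s.1 i) (s.2 i) a)) :
    g (kept s j) ≤ receivedSum c s g j := by
  refine le_add_of_nonneg_right (Finset.sum_nonneg fun i _ => Finset.sum_nonneg fun a ha => ?_)
  split_ifs with h
  · exact hg i a (Finset.mem_range.1 ha) h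
  · exact le_rfl

theorem receivedSum_nonneg (c : V → ℕ → V) (s : (V → ℤ) × (V → ℤ)) {g : ℤ → ℤ} {j : V}
    (hk : 0 ≤ g (kept s j))
    (hg : ∀ i, ∀ a < (s.2 i - 1).toNat, c i a = j → 0 ≤ g (pieceValue (s.1 i) (s.2 i) a)) :
    0 ≤ receivedSum c s g j :=
  hk.trans (kept_le_receivedSum c s hg)

theorem kept_add_le_receivedSum (c : V → ℕ → V) (s : (V → ℤ) × (V → ℤ)) {g : ℤ → ℤ} {i : V}
    {a : ℕ} (ha : a < (s.2 i - 1).toNat)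
    (hg : ∀ i', ∀ a' < (s.2 i' - 1).toNat, c i' a' = c i a →
      0 ≤ g (pieceValue (s.1 i') (s.2 i') a')) :
    g (kept s (c i a)) + g (pieceValue (s.1 i) (s.2 i) a) ≤ receivedSum c s g (c i a) := by
  classical
  have h0 : ∀ i' : V, ∀ a' ∈ Finset.range (s.2 i' - 1).toNat,
      0 ≤ if c i' a' = c i a then g (pieceValue (s.1 i') (s.2 i') a') else 0 := by
    intro i' a' ha'
    split_ifs with h
    · exact hg i' a' (Finset.mem_range.1 ha') h
    · exact le_rfl
  unfold receivedSum
  gcongr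
  calc g (pieceValue (s.1 i) (s.2 i) a)
      = if c i a = c i a then g (pieceValue (s.1 i) (s.2 i) a) else 0 := by simp
    _ ≤ ∑ a' ∈ Finset.range (s.2 i - 1).toNat,
          if c i a' = c i a then g (pieceValue (s.1 i) (s.2 i) a') else 0 :=
        Finset.single_le_sum (h0 i) (Finset.mem_range.2 ha)
    _ ≤ _ := Finset.single_le_sum
        (f := fun i' => ∑ a' ∈ Finset.range (s.2 i' - 1).toNat,
          if c i' a' = c i a then g (pieceValue (s.1 i') (s.2 i') a') else 0)
        (fun i' _ => Finset.sum_nonneg (h0 i')) (Finset.mem_univ i)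

theorem massStep_snd_pos (c : V → ℕ → V) {s : (V → ℤ) × (V → ℤ)} (hs : ∀ j, 0 < s.2 j) (j : V) :
    0 < (massStep c s).2 j := by
  rw [massStep_snd c hs]
  exact zero_lt_one.trans_le
    (kept_le_receivedSum c s (g := fun _ => 1) fun _ _ _ _ => zero_le_one)

theorem sum_massStep_fst (c : V → ℕ → V) {s : (V → ℤ) × (V → ℤ)} (hs : ∀ j, 0 < s.2 j) :
    ∑ j, (massStep c s).1 j = ∑ j, s.1 j := by
  simp only [massStep_fst c hs, sum_receivedSum, piecesSum_id (hs _)]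

theorem sum_massStep_snd (c : V → ℕ → V) {s : (V → ℤ) × (V → ℤ)} (hs : ∀ j, 0 < s.2 j) :
    ∑ j, (massStep c s).2 j = ∑ j, s.2 j := by
  simp only [massStep_snd c hs, sum_receivedSum, piecesSum_one (hs _)]

/-- The sum of the squares of the values of all pieces. -/
def energy (s : (V → ℤ) × (V → ℤ)) : ℤ := ∑ j, piecesSum (fun v => v ^ 2) (s.1 j) (s.2 j)

/-- With f the new kept value at j, subtracting the sum of (v - f)(v - f - 1) from the sum of the
squares received leaves the affine expression of `piecesSum_sq`, the energy after re-splitting. The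
subtracted terms are nonnegative for integers, so they measure the loss. -/
theorem energy_massStep_add (c : V → ℕ → V) {s : (V → ℤ) × (V → ℤ)} (hs : ∀ j, 0 < s.2 j) :
    energy (massStep c s) + ∑ j, receivedSum c s
      (fun v => (v - kept (massStep c s) j) * (v - kept (massStep c s) j - 1)) j = energy s := by
  unfold energy
  rw [← sum_receivedSum c s, ← Finset.sum_add_distrib]
  refine Finset.sum_congr rfl fun j _ => ?_
  set f := kept (massStep c s) j with hf
  have h1 := receivedSum_linear c s (fun v => v) (fun _ => 1) (-(2 * f + 1)) (f * (f + 1)) j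
  have h2 := receivedSum_linear c s (fun v => v ^ 2)
    (fun v => -(2 * f + 1) * v + f * (f + 1) * 1) 1 1 j
  have h3 : (fun v : ℤ => (v - f) * (v - f - 1))
      = fun v => 1 * v ^ 2 + 1 * (-(2 * f + 1) * v + f * (f + 1) * 1) := by
    funext v; ring
  rw [h3, h2, h1, piecesSum_sq (massStep_snd_pos c hs j), ← massStep_fst c hs,
    ← massStep_snd c hs]
  change (2 * f + 1) * _ - f * (f + 1) * _ + _ = _
  ring

theorem mul_pred_nonneg (x : ℤ) : 0 ≤ x * (x - 1) := by
  rcases le_or_gt x 0 with h | h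
  · nlinarith
  · nlinarith

theorem energy_massStep_le (c : V → ℕ → V) {s : (V → ℤ) × (V → ℤ)} (hs : ∀ j, 0 < s.2 j) :
    energy (massStep c s) ≤ energy s := by
  rw [← energy_massStep_add c hs]
  have := Finset.sum_nonneg (s := Finset.univ) fun j _ => receivedSum_nonneg c s
    (g := fun v => (v - kept (massStep c s) j) * (v - kept (massStep c s) j - 1)) (j := j)
    (mul_pred_nonneg _) (fun i a _ _ => mul_pred_nonneg _)
  omega

theorem receivedSum_eq_zero_of_energy_eq (c : V → ℕ → V) {s : (V → ℤ) × (V → ℤ)}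
    (hs : ∀ j, 0 < s.2 j) (h : energy (massStep c s) = energy s) (j : V) :
    receivedSum c s
      (fun v => (v - kept (massStep c s) j) * (v - kept (massStep c s) j - 1)) j = 0 := by
  have h1 := energy_massStep_add c hs
  rw [h, add_eq_left] at h1
  exact (Finset.sum_eq_zero_iff_of_nonneg fun j _ => receivedSum_nonneg c s
    (mul_pred_nonneg _) (fun i a _ _ => mul_pred_nonneg _)).1 h1 j (Finset.mem_univ j)

theorem eq_or_eq_of_mul_pred_le_zero {x f : ℤ} (h : (x - f) * (x - f - 1) ≤ 0) :
    x = f ∨ x = f + 1 := by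
  rcases lt_trichotomy x f with h' | h' | h'
  · nlinarith
  · exact Or.inl h'
  · right; by_contra hne
    have : f + 2 ≤ x := by omega
    nlinarith

/-- The old kept piece is still at j after the exchange, and without energy loss every piece there
equals the new kept value or exceeds it by one. -/
theorem kept_massStep_le_of_energy_eq (c : V → ℕ → V) {s : (V → ℤ) × (V → ℤ)}
    (hs : ∀ j, 0 < s.2 j) (h : energy (massStep c s) = energy s) (j : V) :
    kept (massStep c s) j ≤ kept s j := by
  have h1 := receivedSum_eq_zero_of_energy_eq c hs h j
  have h3 := kept_le_receivedSum c s (j := j) (g := fun v => (v - kept (massStep c s) j)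
    * (v - kept (massStep c s) j - 1)) fun _ _ _ _ => mul_pred_nonneg _
  rw [h1] at h3
  rcases eq_or_eq_of_mul_pred_le_zero h3 with h | h <;> omega

theorem pieceValue_of_energy_eq (c : V → ℕ → V) {s : (V → ℤ) × (V → ℤ)}
    (hs : ∀ j, 0 < s.2 j) (h : energy (massStep c s) = energy s) {i : V} {a : ℕ}
    (ha : a < (s.2 i - 1).toNat) :
    pieceValue (s.1 i) (s.2 i) a = kept (massStep c s) (c i a) ∨
      pieceValue (s.1 i) (s.2 i) a = kept (massStep c s) (c i a) + 1 := by
  have h1 := receivedSum_eq_zero_of_energy_eq c hs h (c i a)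
  have h2 := kept_add_le_receivedSum c s (g := fun v => (v - kept (massStep c s) (c i a))
    * (v - kept (massStep c s) (c i a) - 1)) ha (fun _ _ _ _ => mul_pred_nonneg _)
  have h3 := mul_pred_nonneg (kept s (c i a) - kept (massStep c s) (c i a))
  exact eq_or_eq_of_mul_pred_le_zero (by linarith)

/-- If an exchange changes neither the energy nor the kept values, then a node to which a piece of
value `v` is sent has again a piece of value `v` to hand out. -/
theorem exists_pieceValue_massStep (c : V → ℕ → V) {s : (V → ℤ) × (V → ℤ)}
    (hs : ∀ j, 0 < s.2 j) (he : energy (massStep c s) = energy s)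
    (hk : ∀ j, kept (massStep c s) j = kept s j) {i : V} {a : ℕ} (ha : a < (s.2 i - 1).toNat) :
    ∃ b < ((massStep c s).2 (c i a) - 1).toNat,
      pieceValue ((massStep c s).1 (c i a)) ((massStep c s).2 (c i a)) b
        = pieceValue (s.1 i) (s.2 i) a := by
  have hp : ∀ i', ∀ a' < (s.2 i' - 1).toNat, c i' a' = c i a →
      pieceValue (s.1 i') (s.2 i') a' = kept s (c i a) ∨
      pieceValue (s.1 i') (s.2 i') a' = kept s (c i a) + 1 := by
    intro i' a' ha' h
    have := pieceValue_of_energy_eq c hs he ha'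
    rwa [hk, h] at this
  set j := c i a with hj
  set f := kept s j with hf
  have hz := massStep_snd_pos c hs j
  have hz2 : 1 + 1 ≤ (massStep c s).2 j := by
    rw [massStep_snd c hs]
    exact kept_add_le_receivedSum c s (g := fun _ => 1) ha (fun _ _ _ _ => zero_le_one)
  have hq : quo ((massStep c s).1 j) ((massStep c s).2 j) = f := hk j
  simp only [pieceValue_eq ((massStep c s).1 j), hq]
  rcases hp i a ha rfl with hv | hv
  -- The kept piece and the arriving one both have value f, so (f + 1) z - y ≥ 2: at least two new
  -- pieces are minimal. The last is kept, so the one before it is minimal and handed out.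
  · refine ⟨((massStep c s).2 j - 2).toNat, by omega, ?_⟩
    have h1 := kept_add_le_receivedSum c s (g := fun v => (-1) * v + (f + 1) * 1) ha
      (fun i' a' ha' h => by rcases hp i' a' ha' h with h | h <;> rw [h] <;> linarith)
    rw [receivedSum_linear c s (fun v => v) (fun _ => 1), ← massStep_fst c hs,
      ← massStep_snd c hs, ← hj, ← hf, hv] at h1
    rw [hv, if_neg, add_zero]
    rw [Int.toNat_of_nonneg (by omega)]
    nlinarith
  -- A piece of value f + 1 arrived, so y - f z ≥ 1; the larger pieces come first, so piece 0 is
  -- one.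
  · refine ⟨0, by omega, ?_⟩
    have h1 := kept_add_le_receivedSum c s (g := fun v => 1 * v + (-f) * 1) ha
      (fun i' a' ha' h => by rcases hp i' a' ha' h with h | h <;> rw [h] <;> linarith)
    rw [receivedSum_linear c s (fun v => v) (fun _ => 1), ← massStep_fst c hs,
      ← massStep_snd c hs, ← hj, ← hf, hv] at h1
    rw [hv, if_pos]
    push_cast
    nlinarith

/-- A nonnegative quantity that no exchange increases, for masses whose energy is at most `B`: the
energy and, of secondary importance, the sum of the kept values. -/
def rank (B : ℤ) (s : (V → ℤ) × (V → ℤ)) : ℤ :=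
  (2 * (Fintype.card V * B) + 1) * energy s + ∑ j, kept s j + Fintype.card V * B

theorem abs_kept_le (s : (V → ℤ) × (V → ℤ)) (j : V) : |kept s j| ≤ energy s := by
  have h1 : ∀ i, kept s i ^ 2 ≤ piecesSum (fun v => v ^ 2) (s.1 i) (s.2 i) := fun i =>
    le_add_of_nonneg_right (Finset.sum_nonneg fun _ _ => sq_nonneg _)
  have h2 : piecesSum (fun v => v ^ 2) (s.1 j) (s.2 j) ≤ energy s :=
    Finset.single_le_sum (f := fun i => piecesSum (fun v => v ^ 2) (s.1 i) (s.2 i))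
      (fun i _ => (sq_nonneg _).trans (h1 i)) (Finset.mem_univ j)
  have h3 : |kept s j| ≤ kept s j ^ 2 := by
    rw [← sq_abs]; exact Int.le_self_sq _
  exact h3.trans ((h1 j).trans h2)

theorem energy_nonneg (s : (V → ℤ) × (V → ℤ)) : 0 ≤ energy s :=
  Finset.sum_nonneg fun _ _ => add_nonneg (sq_nonneg _) (Finset.sum_nonneg fun _ _ => sq_nonneg _)

theorem abs_sum_kept_le {s : (V → ℤ) × (V → ℤ)} {B : ℤ} (hB : energy s ≤ B) :
    |∑ j, kept s j| ≤ Fintype.card V * B := by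
  refine (Finset.abs_sum_le_sum_abs _ _).trans ?_
  refine (Finset.sum_le_card_nsmul _ _ B fun j _ => (abs_kept_le s j).trans hB).trans ?_
  simp

theorem rank_nonneg {s : (V → ℤ) × (V → ℤ)} {B : ℤ} (hB : energy s ≤ B) : 0 ≤ rank B s := by
  have h1 := abs_le.1 (abs_sum_kept_le hB)
  have h2 := energy_nonneg s
  have h3 : 0 ≤ (2 * (Fintype.card V * B) + 1) * energy s :=
    mul_nonneg (by have : 0 ≤ (Fintype.card V : ℤ) * B := mul_nonneg (by positivity) (by omega)
                   omega) h2
  unfold rank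
  omega

/-- The sum of the kept values changes by at most 2 |V| B, less than the weight 2 |V| B + 1 that one
unit of energy carries in `rank`. -/
theorem rank_massStep_lt_of_energy_lt (c : V → ℕ → V) {s : (V → ℤ) × (V → ℤ)}
    {B : ℤ} (hB : energy s ≤ B)
    (h : energy (massStep c s) < energy s) : rank B (massStep c s) < rank B s := by
  have h1 := abs_le.1 (abs_sum_kept_le hB)
  have h2 := abs_le.1 (abs_sum_kept_le (h.le.trans hB))
  have h3 : (2 * (Fintype.card V * B) + 1) * energy (massStep c s)
      ≤ (2 * (Fintype.card V * B) + 1) * (energy s - 1) :=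
    mul_le_mul_of_nonneg_left (by omega) (by omega)
  unfold rank
  linarith [h1.1, h1.2, h2.1, h2.2]

theorem rank_massStep_le (c : V → ℕ → V) {s : (V → ℤ) × (V → ℤ)} (hs : ∀ j, 0 < s.2 j)
    {B : ℤ} (hB : energy s ≤ B) : rank B (massStep c s) ≤ rank B s := by
  rcases (energy_massStep_le c hs).lt_or_eq with h | h
  · exact (rank_massStep_lt_of_energy_lt c hB h).le
  · unfold rank
    rw [h]
    gcongr with j
    exact kept_massStep_le_of_energy_eq c hs h j

theorem energy_and_kept_eq_of_rank_eq (c : V → ℕ → V) {s : (V → ℤ) × (V → ℤ)}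
    (hs : ∀ j, 0 < s.2 j) {B : ℤ} (hB : energy s ≤ B) (h : rank B (massStep c s) = rank B s) :
    energy (massStep c s) = energy s ∧ ∀ j, kept (massStep c s) j = kept s j := by
  have he : energy (massStep c s) = energy s := by
    refine (energy_massStep_le c hs).lt_or_eq.resolve_left fun h' => ?_
    exact (rank_massStep_lt_of_energy_lt c hB h').ne h
  refine ⟨he, fun j => ?_⟩
  unfold rank at h
  rw [he] at h
  exact (Finset.sum_eq_sum_iff_of_le fun j _ => kept_massStep_le_of_energy_eq c hs he j).1
    (by omega) j (Finset.mem_univ j)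

/-- All quotients `y j / z j` lie between two consecutive integers. -/
def Balanced (s : (V → ℤ) × (V → ℤ)) : Prop :=
  ∀ i j, ⌈(s.1 i : ℚ) / (s.2 i : ℚ)⌉ - kept s j ≤ 1

/-- All pieces lie between the least kept value and its successor. Sums of such pieces over any node
keep the quotient in this interval. -/
theorem Balanced.massStep [Nonempty V] (c : V → ℕ → V) {s : (V → ℤ) × (V → ℤ)}
    (hs : ∀ j, 0 < s.2 j) (h : Balanced s) : Balanced (massStep c s) := by
  obtain ⟨t, ht⟩ := Finite.exists_min (kept s)
  have hup : ∀ i, ⌈(s.1 i : ℚ) / (s.2 i : ℚ)⌉ ≤ kept s t + 1 := fun i => by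
    have := h i t; omega
  intro i j
  have hi : ⌈((QuantizedOpt.massStep c s).1 i : ℚ) / ((QuantizedOpt.massStep c s).2 i : ℚ)⌉
      ≤ kept s t + 1 := by
    rw [ceil_div_le_iff (massStep_snd_pos c hs i)]
    have := receivedSum_nonneg c s (g := fun v => (-1) * v + (kept s t + 1) * 1) (j := i)
      (by have := (quo_le_ceil (s.1 i) (s.2 i)).trans (hup i)
          simp only [kept] at *; linarith)
      (fun i' a _ _ => by
        have := (pieceValue_le_ceil (y := s.1 i') (hs i') a).trans (hup i')
        linarith)
    rw [receivedSum_linear c s (fun v => v) (fun _ => 1), ← massStep_fst c hs,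
      ← massStep_snd c hs] at this
    linarith
  have hj : kept s t ≤ kept (QuantizedOpt.massStep c s) j := by
    refine (le_quo_iff (massStep_snd_pos c hs j)).2 ?_
    have := receivedSum_nonneg c s (g := fun v => 1 * v + (-kept s t) * 1) (j := j)
      (by linarith [ht j])
      (fun i' a _ _ => by
        have := (ht i').trans (quo_le_pieceValue (s.1 i') (s.2 i') a)
        linarith)
    rw [receivedSum_linear c s (fun v => v) (fun _ => 1), ← massStep_fst c hs,
      ← massStep_snd c hs] at this
    linarith
  omega

/-- Unless the masses are balanced, some piece that is to be handed out and the piece that some node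
keeps would change each other if they met. -/
theorem exists_piece_of_not_balanced {s : (V → ℤ) × (V → ℤ)} (hs : ∀ j, 0 < s.2 j)
    (hsum : (Fintype.card V : ℤ) < ∑ j, s.2 j) (h : ¬ Balanced s) :
    ∃ i, ∃ a < (s.2 i - 1).toNat, ∃ t,
      ¬ (pieceValue (s.1 i) (s.2 i) a = kept s t ∨
        pieceValue (s.1 i) (s.2 i) a = kept s t + 1) := by
  by_contra! hc
  refine h fun i j => ?_
  obtain ⟨l, hl⟩ : ∃ l, 1 < s.2 l := by
    by_contra! h'
    have : ∑ j, s.2 j ≤ ∑ _j : V, 1 := Finset.sum_le_sum fun j _ => h' j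
    simp at this
    omega
  -- Without remainder, the ceiling at i is its kept value, and a piece of l compatible with both i
  -- and j bounds the difference. With remainder, piece 0 of i has value `kept s i + 1` and is
  -- itself handed out, so its compatibility with j suffices.
  by_cases hr : s.1 i ≤ kept s i * s.2 i
  · have h1 := (ceil_div_le_iff (hs i)).2 hr
    have h2 := hc l 0 (by omega) i
    have h3 := hc l 0 (by omega) j
    omega
  · have h1 := ceil_le_quo_add_one (s.1 i) (s.2 i)
    have h4 := lt_quo_add_one_mul (y := s.1 i) (hs i)
    have h5 : 1 < s.2 i := by simp only [kept] at hr; nlinarith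
    have h2 := hc i 0 (by omega) j
    rw [pieceValue_eq, if_pos (by simp only [kept] at hr; push_cast; omega)] at h2
    simp only [kept] at *
    omega

end Masses

/-! ### Consensus windows and the stopping test -/

section TerminationTest

theorem HasPath.cases_succ {V : Type*} {G : Digraph V} {d : ℕ} {i j : V} (h : HasPath G (d + 1) i j) :
    ∃ l, HasPath G d i l ∧ G.Adj l j := by
  obtain ⟨p, h0, h1, h2⟩ := h
  exact ⟨p d, ⟨p, h0, rfl, fun s hs => h2 s (by omega)⟩, h1 ▸ h2 d (by omega)⟩

theorem HasPath.eq_of_zero {V : Type*} {G : Digraph V} {i j : V} (h : HasPath G 0 i j) : i = j := by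
  obtain ⟨p, h0, h1, -⟩ := h
  exact h0.symm.trans h1

theorem HasPath.uncons {V : Type*} {G : Digraph V} {d : ℕ} {i j : V} (h : HasPath G (d + 1) i j) :
    ∃ l, G.Adj i l ∧ HasPath G d l j := by
  obtain ⟨p, h0, h1, h2⟩ := h
  exact ⟨p 1, h0 ▸ h2 0 (by omega), fun s => p (s + 1), rfl, h1, fun s hs => h2 _ (by omega)⟩

variable {V : Type*} [Fintype V]

/-- The masses after the iterations `1, …, k` if no node ever terminates. -/
def massRun (y₀ z₀ : V → ℤ) (X : ℕ → V → ℕ → V) : ℕ → (V → ℤ) × (V → ℤ)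
  | 0 => (fun j => 2 * y₀ j, fun j => 2 * z₀ j)
  | k + 1 => massStep (X (k + 1)) (massRun y₀ z₀ X k)

theorem massRun_snd_pos {y₀ z₀ : V → ℤ} (hz : ∀ j, 0 < z₀ j) (X : ℕ → V → ℕ → V) (k : ℕ) :
    ∀ j, 0 < (massRun y₀ z₀ X k).2 j := by
  induction k with
  | zero => intro j; have := hz j; simp only [massRun]; omega
  | succ k ih => exact massStep_snd_pos _ ih

theorem sum_massRun_fst {y₀ z₀ : V → ℤ} (hz : ∀ j, 0 < z₀ j) (X : ℕ → V → ℕ → V) (k : ℕ) :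
    ∑ j, (massRun y₀ z₀ X k).1 j = 2 * ∑ j, y₀ j := by
  induction k with
  | zero => simp [massRun, Finset.mul_sum]
  | succ k ih => rw [massRun, sum_massStep_fst _ (massRun_snd_pos hz X k), ih]

theorem sum_massRun_snd {y₀ z₀ : V → ℤ} (hz : ∀ j, 0 < z₀ j) (X : ℕ → V → ℕ → V) (k : ℕ) :
    ∑ j, (massRun y₀ z₀ X k).2 j = 2 * ∑ j, z₀ j := by
  induction k with
  | zero => simp [massRun, Finset.mul_sum]
  | succ k ih => rw [massRun, sum_massStep_snd _ (massRun_snd_pos hz X k), ih]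

section Run

variable (G : Digraph V) (D : ℕ) (y₀ z₀ : V → ℤ) (X : ℕ → V → ℕ → V)

/-- No node has terminated after `k` iterations. -/
def Active (k : ℕ) : Prop := ∀ j, (run G D y₀ z₀ X k).flag j = false

theorem masses_run_of_active {k : ℕ} (h : ∀ k' < k, Active G D y₀ z₀ X k') :
    ((run G D y₀ z₀ X k).y, (run G D y₀ z₀ X k).z) = massRun y₀ z₀ X k := by
  induction k with
  | zero => rfl
  | succ k ih =>
    have hk := h k (Nat.lt_succ_self k)
    rw [massRun, ← ih fun k' hk' => h k' (by omega)]
    unfold Active at hk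
    simp [run, step, massStep, hk]

variable {G D y₀ z₀ X}

theorem not_modEq_one_of_lt {w t : ℕ} (ht : t + 1 < D) : ¬ w * D + (t + 1) + 1 ≡ 1 [MOD D] := by
  intro h
  have h2 : t + 1 ≡ 0 [MOD D] := by
    have h3 : w * D + (t + 1) + 1 ≡ 0 + 1 [MOD D] := by simpa using h
    have h4 := Nat.ModEq.add_right_cancel' 1 h3
    have h5 : w * D + (t + 1) ≡ w * D + 0 [MOD D] :=
      h4.trans ((Nat.modEq_zero_iff_dvd.2 (Dvd.intro_left w (by simp))).symm)
    exact Nat.ModEq.add_left_cancel' _ h5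
  have := Nat.le_of_dvd (by omega) (Nat.modEq_zero_iff_dvd.1 h2)
  omega

theorem modEq_one_start (w : ℕ) : w * D + 0 + 1 ≡ 1 [MOD D] := by
  have : w * D ≡ 0 [MOD D] := Nat.modEq_zero_iff_dvd.2 (Dvd.intro_left w rfl)
  exact this.add_right 1

theorem mem_senders_self (s : State V) (j : V) : j ∈ senders G s j := by simp [senders]

theorem exists_sender {s : State V} (hs : ∀ j, s.flag j = false) {d t : ℕ} (hd : d ≤ t + 1)
    {i j : V} (h : HasPath G d i j) : ∃ l ∈ senders G s j, ∃ d' ≤ t, HasPath G d' i l := by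
  rcases Nat.lt_or_ge t d with h' | h'
  · obtain rfl : d = t + 1 := by omega
    obtain ⟨l, hl, hlj⟩ := h.cases_succ
    exact ⟨l, by simp [senders, hlj, hs l], t, le_rfl, hl⟩
  · exact ⟨j, mem_senders_self s j, d, h', h⟩

/-- The quotient of the masses of node `j`, rounded up. -/
def upper (s : (V → ℤ) × (V → ℤ)) (j : V) : ℤ := ⌈(s.1 j : ℚ) / (s.2 j : ℚ)⌉

/-- Flooding invariant: t exchanges after the reset at the start of window w, a node holds one of
the initial ceilings, at least as large as those of all nodes with a path of length at most t to it.
-/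
theorem broadcastMax_spec {w t : ℕ} (ht : t < D)
    (h : ∀ k ≤ w * D + t, Active G D y₀ z₀ X k) (j : V) :
    (∃ i, broadcastMax D (w * D + t + 1) (run G D y₀ z₀ X (w * D + t)) j
      = upper (massRun y₀ z₀ X (w * D)) i) ∧
    ∀ i, ∀ d ≤ t, HasPath G d i j → upper (massRun y₀ z₀ X (w * D)) i
      ≤ broadcastMax D (w * D + t + 1) (run G D y₀ z₀ X (w * D + t)) j := by
  induction t generalizing j with
  | zero =>
    have hm := masses_run_of_active G D y₀ z₀ X (k := w * D) fun k hk => h k (by omega)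
    rw [broadcastMax, if_pos (modEq_one_start w), ← hm]
    refine ⟨⟨j, rfl⟩, fun i d hd hp => ?_⟩
    obtain rfl : d = 0 := by omega
    rw [hp.eq_of_zero]
    rfl
  | succ t ih =>
    have ih' := ih (by omega) fun k hk => h k (by omega)
    have hact := h (w * D + t) (by omega)
    have hval : broadcastMax D (w * D + (t + 1) + 1) (run G D y₀ z₀ X (w * D + (t + 1))) j
        = newMax G D (w * D + t + 1) (run G D y₀ z₀ X (w * D + t)) j := by
      rw [broadcastMax, if_neg (not_modEq_one_of_lt ht)]
      change (if (run G D y₀ z₀ X (w * D + t)).flag j then _ else _) = _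
      rw [hact j]
      rfl
    rw [hval]
    constructor
    · obtain ⟨l, -, hl⟩ := Finset.exists_mem_eq_sup' (senders_nonempty G _ j)
        (broadcastMax D (w * D + t + 1) (run G D y₀ z₀ X (w * D + t)))
      rw [newMax, hl]
      exact (ih' l).1
    · intro i d hd hp
      obtain ⟨l, hl, d', hd', hp'⟩ := exists_sender hact hd hp
      exact ((ih' l).2 i d' hd' hp').trans (Finset.le_sup' _ hl)

theorem broadcastMin_spec {w t : ℕ} (ht : t < D)
    (h : ∀ k ≤ w * D + t, Active G D y₀ z₀ X k) (j : V) :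
    (∃ i, broadcastMin D (w * D + t + 1) (run G D y₀ z₀ X (w * D + t)) j
      = kept (massRun y₀ z₀ X (w * D)) i) ∧
    ∀ i, ∀ d ≤ t, HasPath G d i j →
      broadcastMin D (w * D + t + 1) (run G D y₀ z₀ X (w * D + t)) j
        ≤ kept (massRun y₀ z₀ X (w * D)) i := by
  induction t generalizing j with
  | zero =>
    have hm := masses_run_of_active G D y₀ z₀ X (k := w * D) fun k hk => h k (by omega)
    rw [broadcastMin, if_pos (modEq_one_start w), ← hm]
    refine ⟨⟨j, rfl⟩, fun i d hd hp => ?_⟩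
    obtain rfl : d = 0 := by omega
    rw [hp.eq_of_zero]
    rfl
  | succ t ih =>
    have ih' := ih (by omega) fun k hk => h k (by omega)
    have hact := h (w * D + t) (by omega)
    have hval : broadcastMin D (w * D + (t + 1) + 1) (run G D y₀ z₀ X (w * D + (t + 1))) j
        = newMin G D (w * D + t + 1) (run G D y₀ z₀ X (w * D + t)) j := by
      rw [broadcastMin, if_neg (not_modEq_one_of_lt ht)]
      change (if (run G D y₀ z₀ X (w * D + t)).flag j then _ else _) = _
      rw [hact j]
      rfl
    rw [hval]
    constructor
    · obtain ⟨l, -, hl⟩ := Finset.exists_mem_eq_inf' (senders_nonempty G _ j)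
        (broadcastMin D (w * D + t + 1) (run G D y₀ z₀ X (w * D + t)))
      rw [newMin, hl]
      exact (ih' l).1
    · intro i d hd hp
      obtain ⟨l, hl, d', hd', hp'⟩ := exists_sender hact hd hp
      exact (Finset.inf'_le _ hl).trans ((ih' l).2 i d' hd' hp')

theorem newMax_spec (hG : ∀ i j, ∃ d ≤ D, HasPath G d i j) {w t : ℕ} (ht : t + 1 = D)
    (h : ∀ k ≤ w * D + t, Active G D y₀ z₀ X k) (j : V) :
    (∃ i, newMax G D (w * D + t + 1) (run G D y₀ z₀ X (w * D + t)) j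
      = upper (massRun y₀ z₀ X (w * D)) i) ∧
    ∀ i, upper (massRun y₀ z₀ X (w * D)) i
      ≤ newMax G D (w * D + t + 1) (run G D y₀ z₀ X (w * D + t)) j := by
  have hb := broadcastMax_spec (G := G) (D := D) (by omega) h
  constructor
  · obtain ⟨l, -, hl⟩ := Finset.exists_mem_eq_sup' (senders_nonempty G _ j)
      (broadcastMax D (w * D + t + 1) (run G D y₀ z₀ X (w * D + t)))
    rw [newMax, hl]
    exact (hb l).1
  · intro i
    obtain ⟨d, hd, hp⟩ := hG i j
    obtain ⟨l, hl, d', hd', hp'⟩ := exists_sender (h _ le_rfl) (hd.trans ht.ge) hp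
    exact ((hb l).2 i d' hd' hp').trans (Finset.le_sup' _ hl)

theorem newMin_spec (hG : ∀ i j, ∃ d ≤ D, HasPath G d i j) {w t : ℕ} (ht : t + 1 = D)
    (h : ∀ k ≤ w * D + t, Active G D y₀ z₀ X k) (j : V) :
    (∃ i, newMin G D (w * D + t + 1) (run G D y₀ z₀ X (w * D + t)) j
      = kept (massRun y₀ z₀ X (w * D)) i) ∧
    ∀ i, newMin G D (w * D + t + 1) (run G D y₀ z₀ X (w * D + t)) j
      ≤ kept (massRun y₀ z₀ X (w * D)) i := by
  have hb := broadcastMin_spec (G := G) (D := D) (by omega) h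
  constructor
  · obtain ⟨l, -, hl⟩ := Finset.exists_mem_eq_inf' (senders_nonempty G _ j)
      (broadcastMin D (w * D + t + 1) (run G D y₀ z₀ X (w * D + t)))
    rw [newMin, hl]
    exact (hb l).1
  · intro i
    obtain ⟨d, hd, hp⟩ := hG i j
    obtain ⟨l, hl, d', hd', hp'⟩ := exists_sender (h _ le_rfl) (hd.trans ht.ge) hp
    exact (Finset.inf'_le _ hl).trans ((hb l).2 i d' hd' hp')

/-- At the end of a window of `D` iterations a node stops if and only if the masses at the beginning
of the window were balanced. -/
theorem stops_iff_balanced (hG : ∀ i j, ∃ d ≤ D, HasPath G d i j) {w t : ℕ} (ht : t + 1 = D)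
    (h : ∀ k ≤ w * D + t, Active G D y₀ z₀ X k) (j : V) :
    Stops G D (w * D + t + 1) (run G D y₀ z₀ X (w * D + t)) j
      ↔ Balanced (massRun y₀ z₀ X (w * D)) := by
  obtain ⟨⟨a, ha⟩, hM⟩ := newMax_spec hG ht h j
  obtain ⟨⟨b, hb⟩, hm⟩ := newMin_spec hG ht h j
  have hmod : w * D + t + 1 ≡ 0 [MOD D] :=
    Nat.modEq_zero_iff_dvd.2 ⟨w + 1, by rw [add_assoc, ht]; ring⟩
  constructor
  · rintro ⟨-, hs⟩ i i'
    have h1 := hM i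
    have h2 := hm i'
    change upper _ i - _ ≤ 1
    omega
  · intro hB
    refine ⟨hmod, ?_⟩
    rw [ha, hb]
    exact hB a b

/-- A first raised flag can only occur at the end of a window, and there it would certify balance at
the start of a window before W. -/
theorem active_of_not_balanced (hD : 0 < D) (hG : ∀ i j, ∃ d ≤ D, HasPath G d i j) {W : ℕ}
    (hW : ∀ w < W, ¬ Balanced (massRun y₀ z₀ X (w * D))) {k : ℕ} (hk : k < (W + 1) * D) :
    Active G D y₀ z₀ X k := by
  classical
  induction k using Nat.strong_induction_on with
  | _ k ih =>
    rcases k with _ | k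
    · exact fun _ => rfl
    · intro j
      have hact : ∀ k' ≤ k, Active G D y₀ z₀ X k' := fun k' hk' => ih k' (by omega) (by omega)
      change ((run G D y₀ z₀ X k).flag j || decide _) = false
      rw [hact k le_rfl j, Bool.false_or, decide_eq_false_iff_not]
      intro hs
      obtain ⟨u, hu⟩ := Nat.modEq_zero_iff_dvd.1 hs.1
      rcases u with _ | w
      · simp at hu
      · have hk' : k = w * D + (D - 1) := by
          have : D * (w + 1) = w * D + D := by ring
          omega
        have hw : w < W := by
          have : (w + 1) * D < (W + 1) * D := by
            calc (w + 1) * D = k + 1 := by rw [hu]; ring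
              _ < _ := hk
          have := lt_of_mul_lt_mul_right this (Nat.zero_le D)
          omega
        subst hk'
        exact hW w hw ((stops_iff_balanced hG (by omega) hact j).1 hs)

theorem step_of_flag {s : State V} (hs : ∀ j, s.flag j = true) (k : ℕ) (c : V → ℕ → V) :
    step G D k c s = s := by
  cases s
  simp only at hs
  simp [step, funext hs]

theorem run_eq_of_flag {K : ℕ} (hK : ∀ j, (run G D y₀ z₀ X K).flag j = true) {k : ℕ}
    (hk : K ≤ k) : run G D y₀ z₀ X k = run G D y₀ z₀ X K := by
  induction k, hk using Nat.le_induction with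
  | base => rfl
  | succ k _ ih => rw [run, ih, step_of_flag hK]

/-- The global ratio is a weighted mean of quotients in [f, f + 1], f the least kept value; it stays
below f + 1 because the quotient at i does so strictly. -/
theorem eq_floor_of_balanced {s : (V → ℤ) × (V → ℤ)} (hs : ∀ j, 0 < s.2 j) (hB : Balanced s)
    {i : V} (hi : ∀ j, kept s i ≤ kept s j) :
    kept s i = ⌊((∑ j, s.1 j : ℤ) : ℚ) / ((∑ j, s.2 j : ℤ) : ℚ)⌋ := by
  have hpos : 0 < ∑ j, s.2 j := Finset.sum_pos (fun j _ => hs j) ⟨i, Finset.mem_univ i⟩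
  have h1 : kept s i ≤ quo (∑ j, s.1 j) (∑ j, s.2 j) := by
    rw [le_quo_iff hpos, Finset.mul_sum]
    exact Finset.sum_le_sum fun j _ => (le_quo_iff (hs j)).1 (hi j)
  have h2 : quo (∑ j, s.1 j) (∑ j, s.2 j) < kept s i + 1 := by
    by_contra! h
    rw [le_quo_iff hpos, Finset.mul_sum] at h
    refine absurd h (not_le.2 (Finset.sum_lt_sum (fun j _ => ?_)
      ⟨i, Finset.mem_univ i, lt_quo_add_one_mul (hs i)⟩))
    refine (ceil_div_le_iff (hs j)).1 ?_
    have := hB j i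
    omega
  change _ = quo _ _
  omega

/-- If the masses are first balanced at the beginning of the window `W`, then all nodes terminate
simultaneously at the end of this window. -/
theorem run_of_first_balanced (hD : 0 < D) (hG : ∀ i j, ∃ d ≤ D, HasPath G d i j)
    (hz : ∀ j, 0 < z₀ j) {W : ℕ}
    (hW : ∀ w < W, ¬ Balanced (massRun y₀ z₀ X (w * D)))
    (hB : Balanced (massRun y₀ z₀ X (W * D))) :
    (∀ k < (W + 1) * D, Active G D y₀ z₀ X k) ∧
    ∀ j, (run G D y₀ z₀ X ((W + 1) * D)).flag j = true ∧
      (run G D y₀ z₀ X ((W + 1) * D)).qs j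
        = ⌊((∑ j, y₀ j : ℤ) : ℚ) / ((∑ j, z₀ j : ℤ) : ℚ)⌋ := by
  have hact : ∀ k < (W + 1) * D, Active G D y₀ z₀ X k :=
    fun k hk => active_of_not_balanced hD hG hW hk
  classical
  refine ⟨hact, fun j => ?_⟩
  have hK : (W + 1) * D = W * D + (D - 1) + 1 := by
    have : (W + 1) * D = W * D + D := by ring
    omega
  have hact' : ∀ k ≤ W * D + (D - 1), Active G D y₀ z₀ X k := fun k hk => hact k (by omega)
  have hst := (stops_iff_balanced hG (by omega) hact' j).2 hB
  rw [hK]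
  constructor
  · change (_ || decide _) = true
    rw [decide_eq_true hst, Bool.or_true]
  · change (if (run G D y₀ z₀ X (W * D + (D - 1))).flag j then _ else if _ then _ else _) = _
    rw [hact' _ le_rfl j, if_neg Bool.false_ne_true, if_pos hst]
    obtain ⟨⟨b, hb⟩, hm⟩ := newMin_spec hG (by omega) hact' j
    rw [hb, eq_floor_of_balanced (massRun_snd_pos hz X _) hB fun i => hb ▸ hm i,
      sum_massRun_fst hz, sum_massRun_snd hz]
    push_cast
    rw [mul_div_mul_left _ _ two_ne_zero]

end Run

end TerminationTest

/-! ### Probability that the rank drops -/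

section Descent

/-- Elementary conditioning on a countably valued f: a bound on each fibre sums to a bound on A. -/
theorem mul_measure_le_of_fibers {Ω S : Type*} [MeasurableSpace Ω] {μ : Measure Ω} [Countable S]
    {f : Ω → S} (hf : ∀ s, MeasurableSet (f ⁻¹' {s})) {A E : Set Ω} {c : ENNReal}
    (h : ∀ s, c * μ (A ∩ f ⁻¹' {s}) ≤ μ (A ∩ f ⁻¹' {s} ∩ E)) : c * μ A ≤ μ (A ∩ E) := by
  have key : ∀ B : Set Ω, μ B = ∑' s, μ (B ∩ f ⁻¹' {s}) := by
    intro B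
    have h1 : μ.restrict B (⋃ s, f ⁻¹' {s}) = ∑' s, μ.restrict B (f ⁻¹' {s}) :=
      measure_iUnion (fun s s' hs => by
        refine Set.disjoint_left.2 fun ω h h' => hs ?_
        exact (Set.mem_singleton_iff.1 h).symm.trans (Set.mem_singleton_iff.1 h')) hf
    have h2 : (⋃ s, f ⁻¹' {s}) = Set.univ := by ext ω; simp
    rw [h2, Measure.restrict_apply_univ] at h1
    simp only [h1, Measure.restrict_apply (hf _), Set.inter_comm B]
  rw [key A, key (A ∩ E), ← ENNReal.tsum_mul_left]
  refine ENNReal.tsum_le_tsum fun s => (h s).trans_eq ?_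
  rw [Set.inter_right_comm]

/-- The events that depend only on the choices of the iterations `1, …, k`. -/
@[reducible]
def past {V Ω : Type*} (X : ℕ → V → ℕ → Ω → V) (k : ℕ) : MeasurableSpace Ω :=
  ⨆ t ∈ {t : ℕ × V × ℕ | t.1 ≤ k}, MeasurableSpace.comap (X t.1 t.2.1 t.2.2) ⊤

theorem past_mono {V Ω : Type*} {X : ℕ → V → ℕ → Ω → V} {k k' : ℕ} (h : k ≤ k') : past X k ≤ past X k' :=
  biSup_mono fun _ ht => le_trans (b := k) ht h

theorem measurableSet_past {V Ω : Type*} {X : ℕ → V → ℕ → Ω → V} {k k' : ℕ} (h : k ≤ k') (j : V) (i : ℕ) (l : V) :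
    MeasurableSet[past X k'] {ω | X k j i ω = l} := by
  refine le_iSup₂_of_le (f := fun (t : ℕ × V × ℕ) (_ : t ∈ {t : ℕ × V × ℕ | t.1 ≤ k'}) =>
    MeasurableSpace.comap (X t.1 t.2.1 t.2.2) ⊤) (k, j, i) h le_rfl _ ?_
  exact ⟨{l}, trivial, rfl⟩

variable {V : Type*} [Fintype V]

theorem rank_massRun_le {y₀ z₀ : V → ℤ} (hz : ∀ j, 0 < z₀ j) (X : ℕ → V → ℕ → V) {B : ℤ}
    {k : ℕ} (hB : energy (massRun y₀ z₀ X k) ≤ B) (d : ℕ) :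
    rank B (massRun y₀ z₀ X (k + d)) ≤ rank B (massRun y₀ z₀ X k) ∧
      energy (massRun y₀ z₀ X (k + d)) ≤ B := by
  induction d with
  | zero => exact ⟨le_rfl, hB⟩
  | succ d ih =>
    have hs := massRun_snd_pos (y₀ := y₀) hz X (k + d)
    exact ⟨(rank_massStep_le _ hs ih.2).trans ih.1, (energy_massStep_le _ hs).trans ih.2⟩

theorem energy_massRun_le {y₀ z₀ : V → ℤ} (hz : ∀ j, 0 < z₀ j) (X : ℕ → V → ℕ → V) (k : ℕ) :
    energy (massRun y₀ z₀ X k) ≤ energy (fun j => 2 * y₀ j, fun j => 2 * z₀ j) := by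
  have := (rank_massRun_le (k := 0) hz X (y₀ := y₀) le_rfl k).2
  rwa [zero_add] at this

theorem balanced_massRun_add [Nonempty V] {y₀ z₀ : V → ℤ} (hz : ∀ j, 0 < z₀ j)
    (X : ℕ → V → ℕ → V) {k : ℕ} (h : Balanced (massRun y₀ z₀ X k)) (d : ℕ) :
    Balanced (massRun y₀ z₀ X (k + d)) := by
  induction d with
  | zero => exact h
  | succ d ih => exact ih.massStep _ (massRun_snd_pos hz X (k + d))

/-- The masses are balanced or their rank is less than `r`. -/
def NearBalanced (B r : ℤ) (s : (V → ℤ) × (V → ℤ)) : Prop := Balanced s ∨ rank B s < r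

theorem nearBalanced_massRun_add [Nonempty V] {y₀ z₀ : V → ℤ} (hz : ∀ j, 0 < z₀ j)
    (X : ℕ → V → ℕ → V) {k : ℕ} {B r : ℤ} (hB : energy (massRun y₀ z₀ X k) ≤ B)
    (h : NearBalanced B r (massRun y₀ z₀ X k)) (d : ℕ) :
    NearBalanced B r (massRun y₀ z₀ X (k + d)) :=
  h.imp (fun h => balanced_massRun_add hz X h d)
    fun h => (rank_massRun_le hz X hB d).1.trans_lt h

/-- The least probability with which a node selects a given neighbour. -/
def minProb (G : Digraph V) : ℝ := 1 / (1 + (maxOutDegree G : ℝ))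

theorem minProb_pos (G : Digraph V) : 0 < minProb G := by unfold minProb; positivity

theorem minProb_le_one (G : Digraph V) : minProb G ≤ 1 := by
  unfold minProb
  rw [div_le_one (by positivity)]
  simp

theorem minProb_le_transmitProb {G : Digraph V} {j l : V} (h : G.Adj j l) :
    minProb G ≤ transmitProb G l j := by
  rw [transmitProb, if_pos (Or.inr h), minProb]
  have : outDegree G j ≤ maxOutDegree G :=
    Finset.le_sup (f := fun j => outDegree G j) (Finset.mem_univ j)
  have : (outDegree G j : ℝ) ≤ maxOutDegree G := by exact_mod_cast this
  gcongr

section Probability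

variable {Ω : Type*} (X : ℕ → V → ℕ → Ω → V)

/-- The random masses after `k` iterations. -/
def randomMass (y₀ z₀ : V → ℤ) (k : ℕ) (ω : Ω) : (V → ℤ) × (V → ℤ) :=
  massRun y₀ z₀ (fun k j i => X k j i ω) k

variable {X}

theorem measurable_massStep_past (k : ℕ) (s : (V → ℤ) × (V → ℤ)) :
    Measurable[past X k] fun ω => massStep (fun j i => X k j i ω) s := by
  let _ := past X k
  classical
  have h : ∀ j i l (a : ℤ), Measurable fun ω => if X k j i ω = l then a else 0 := fun j i l a =>
    Measurable.ite (measurableSet_past le_rfl j i l) measurable_const measurable_const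
  refine Measurable.prodMk ?_ ?_
  · refine measurable_pi_lambda _ fun j => ?_
    refine Measurable.const_add ?_ _
    refine Finset.measurable_sum _ fun i _ => Finset.measurable_sum _ fun a _ => ?_
    convert h i a j _
  · refine measurable_pi_lambda _ fun j => ?_
    refine Measurable.const_add ?_ _
    refine Finset.measurable_sum _ fun i _ => Finset.measurable_sum _ fun a _ => ?_
    convert h i a j _

theorem measurableSet_past_randomMass (y₀ z₀ : V → ℤ) (k : ℕ) (S : Set ((V → ℤ) × (V → ℤ))) :
    MeasurableSet[past X k] {ω | randomMass X y₀ z₀ k ω ∈ S} := by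
  induction k generalizing S with
  | zero => exact MeasurableSet.const (((fun j => 2 * y₀ j, fun j => 2 * z₀ j) : (V → ℤ) × (V → ℤ)) ∈ S)
  | succ k ih =>
    have : {ω | randomMass X y₀ z₀ (k + 1) ω ∈ S} = ⋃ s, ({ω | randomMass X y₀ z₀ k ω ∈ ({s} : Set _)}
        ∩ {ω | massStep (fun j i => X (k + 1) j i ω) s ∈ S}) := by
      ext ω
      simp [randomMass, massRun]
    rw [this]
    refine MeasurableSet.iUnion fun s => MeasurableSet.inter ?_ ?_
    · exact past_mono k.le_succ _ (ih {s})
    · exact measurable_massStep_past (k + 1) s S.to_countable.measurableSet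

variable {G : Digraph V} [MeasurableSpace Ω] {μ : Measure Ω}

theorem past_le (h : IsRandomChoice G μ X) (k : ℕ) : past X k ≤ ‹MeasurableSpace Ω› :=
  iSup₂_le fun t _ => (h.measurable t.1 t.2.1 t.2.2).comap_le

theorem measurableSet_randomMass (h : IsRandomChoice G μ X) (y₀ z₀ : V → ℤ) (k : ℕ)
    (S : Set ((V → ℤ) × (V → ℤ))) : MeasurableSet {ω | randomMass X y₀ z₀ k ω ∈ S} :=
  past_le h k _ (measurableSet_past_randomMass y₀ z₀ k S)

theorem measure_inter_choice (h : IsRandomChoice G μ X) {k : ℕ} {A : Set Ω}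
    (hA : MeasurableSet[past X k] A) (j : V) (i : ℕ) (l : V) :
    μ (A ∩ {ω | X (k + 1) j i ω = l}) = μ A * ENNReal.ofReal (transmitProb G l j) := by
  have h1 := indep_iSup_of_disjoint (fun t : ℕ × V × ℕ =>
      (h.measurable t.1 t.2.1 t.2.2).comap_le) h.indep.iIndep
    (S := {t | t.1 ≤ k}) (T := {(k + 1, j, i)}) (by
      rw [Set.disjoint_singleton_right]; simp)
  rw [Indep_iff] at h1
  have h2 : MeasurableSet[⨆ t ∈ ({(k + 1, j, i)} : Set (ℕ × V × ℕ)),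
      MeasurableSpace.comap (X t.1 t.2.1 t.2.2) ⊤] {ω | X (k + 1) j i ω = l} := by
    rw [iSup_singleton]
    exact ⟨{l}, trivial, rfl⟩
  rw [h1 A _ hA h2, h.law]

variable {y₀ z₀ : V → ℤ}

/-- A piece that meets a node whose kept piece it would change lowers the rank. -/
theorem pow_mul_measure_le_of_hasPath (h : IsRandomChoice G μ X) (hz : ∀ j, 0 < z₀ j) {B : ℤ}
    (hB : energy (fun j => 2 * y₀ j, fun j => 2 * z₀ j) ≤ B)
    {d k : ℕ} {A : Set Ω} {s : (V → ℤ) × (V → ℤ)} {i t : V} {a : ℕ}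
    (hA : MeasurableSet[past X k] A) (hAs : ∀ ω ∈ A, randomMass X y₀ z₀ k ω = s)
    (hp : HasPath G d i t) (ha : a < (s.2 i - 1).toNat)
    (hv : ¬ (pieceValue (s.1 i) (s.2 i) a = kept s t ∨
      pieceValue (s.1 i) (s.2 i) a = kept s t + 1)) :
    ENNReal.ofReal (minProb G) ^ d * μ A
      ≤ μ (A ∩ {ω | rank B (randomMass X y₀ z₀ (k + d) ω) < rank B s}) := by
  induction d generalizing k A s i a with
  | zero =>
    -- The piece now sits at t, where every piece has the kept value or one more, so this case is
    -- contradictory.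
    rw [hp.eq_of_zero] at hv
    exact absurd (pieceValue_eq_or _ _ _) hv
  | succ d ih =>
    obtain ⟨l, hil, hlt⟩ := hp.uncons
    set E := {ω | rank B (randomMass X y₀ z₀ (k + (d + 1)) ω) < rank B s} with hE
    set A' := A ∩ {ω | X (k + 1) i a ω = l} with hA'
    have hA'm : MeasurableSet[past X (k + 1)] A' :=
      MeasurableSet.inter (past_mono k.le_succ _ hA) (measurableSet_past le_rfl i a l)
    have h1 : ENNReal.ofReal (minProb G) * μ A ≤ μ A' := by
      rw [hA', measure_inter_choice h hA, mul_comm]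
      gcongr
      exact minProb_le_transmitProb hil
    have h2 : ENNReal.ofReal (minProb G) ^ d * μ A' ≤ μ (A' ∩ E) := by
      refine mul_measure_le_of_fibers (f := randomMass X y₀ z₀ (k + 1))
        (fun s' => measurableSet_randomMass h y₀ z₀ (k + 1) {s'}) fun s' => ?_
      -- The sample point ω is only a witness: the facts drawn from it concern s and s' alone, hence
      -- hold on the whole fibre. Either the rank has dropped for good, or a piece of the same value
      -- awaits at l and the kept value at t is unchanged.
      rcases (A' ∩ randomMass X y₀ z₀ (k + 1) ⁻¹' {s'}).eq_empty_or_nonempty with he | ⟨ω, hω⟩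
      · simp [he]
      have hωs : randomMass X y₀ z₀ k ω = s := hAs ω hω.1.1
      have hs : ∀ j, 0 < s.2 j := hωs ▸ massRun_snd_pos hz _ k
      have hsB : energy s ≤ B := hωs ▸ (energy_massRun_le hz _ k).trans hB
      have hs' : s' = massStep (fun j i => X (k + 1) j i ω) s := by
        rw [← hωs]; exact hω.2.symm
      have hl : X (k + 1) i a ω = l := hω.1.2
      rcases (rank_massStep_le (fun j i => X (k + 1) j i ω) hs hsB).lt_or_eq with hr | hr
      · have hsub : A' ∩ randomMass X y₀ z₀ (k + 1) ⁻¹' {s'} ∩ E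
            = A' ∩ randomMass X y₀ z₀ (k + 1) ⁻¹' {s'} := by
          refine Set.inter_eq_left.2 fun ω' hω' => ?_
          have h3 := (rank_massRun_le (y₀ := y₀) (z₀ := z₀) hz (fun k j i => X k j i ω')
            (k := k + 1) ((energy_massRun_le hz _ _).trans hB) d).1
          have h4 : massRun y₀ z₀ (fun k j i => X k j i ω') (k + 1) = s' := hω'.2
          rw [h4, add_assoc, add_comm 1 d] at h3
          rw [← hs'] at hr
          exact h3.trans_lt hr
        rw [hsub]
        refine mul_le_of_le_one_left' (pow_le_one' ?_ d)
        rw [ENNReal.ofReal_le_one]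
        exact minProb_le_one G
      · obtain ⟨h3, h4⟩ := energy_and_kept_eq_of_rank_eq _ hs hsB hr
        obtain ⟨b, hb, hbv⟩ := exists_pieceValue_massStep _ hs h3 h4 ha
        rw [← hs', hl] at hb hbv
        rw [← hs'] at hr h4
        have h5 := ih (k := k + 1) (A := A' ∩ randomMass X y₀ z₀ (k + 1) ⁻¹' {s'}) (s := s')
          (MeasurableSet.inter hA'm (measurableSet_past_randomMass y₀ z₀ (k + 1) {s'}))
          (fun ω' hω' => hω'.2) hlt hb (by rwa [hbv, h4])
        rwa [hr, add_assoc, add_comm 1 d] at h5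
    calc ENNReal.ofReal (minProb G) ^ (d + 1) * μ A
        = ENNReal.ofReal (minProb G) ^ d * (ENNReal.ofReal (minProb G) * μ A) := by ring
      _ ≤ ENNReal.ofReal (minProb G) ^ d * μ A' := by gcongr
      _ ≤ μ (A' ∩ E) := h2
      _ ≤ μ (A ∩ E) := by gcongr; exact Set.inter_subset_left

variable [Nonempty V]

/-- Within `D` iterations the rank drops with probability at least `minProb G ^ D`. -/
theorem pow_mul_measure_le_nearBalanced (h : IsRandomChoice G μ X) (hz : ∀ j, 0 < z₀ j) {B : ℤ}
    (hB : energy (fun j => 2 * y₀ j, fun j => 2 * z₀ j) ≤ B)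
    {D : ℕ} (hG : ∀ i j, ∃ d ≤ D, HasPath G d i j) {k : ℕ} {A : Set Ω} {r : ℤ}
    (hA : MeasurableSet[past X k] A)
    (hAr : ∀ ω ∈ A, NearBalanced B (r + 1) (randomMass X y₀ z₀ k ω)) :
    ENNReal.ofReal (minProb G) ^ D * μ A
      ≤ μ (A ∩ {ω | NearBalanced B r (randomMass X y₀ z₀ (k + D) ω)}) := by
  have hq : ENNReal.ofReal (minProb G) ≤ 1 := ENNReal.ofReal_le_one.2 (minProb_le_one G)
  refine mul_measure_le_of_fibers (f := randomMass X y₀ z₀ k)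
    (fun s => measurableSet_randomMass h y₀ z₀ k {s}) fun s => ?_
  set A' := A ∩ randomMass X y₀ z₀ k ⁻¹' {s} with hA'
  rcases A'.eq_empty_or_nonempty with he | ⟨ω, hω⟩
  · simp [he]
  have hωs : randomMass X y₀ z₀ k ω = s := hω.2
  have hs : ∀ j, 0 < s.2 j := hωs ▸ massRun_snd_pos hz _ k
  by_cases hbal : Balanced s
  · have hsub : A' ∩ {ω | NearBalanced B r (randomMass X y₀ z₀ (k + D) ω)} = A' := by
      refine Set.inter_eq_left.2 fun ω' hω' => Or.inl ?_
      have h1 : randomMass X y₀ z₀ k ω' = s := hω'.2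
      exact balanced_massRun_add hz _ (k := k) (by rw [← h1] at hbal; exact hbal) D
    rw [hsub]
    exact mul_le_of_le_one_left' (pow_le_one' hq D)
  -- The doubling enters here: the conserved total is at least 2 |V|.
  · have hsum : (Fintype.card V : ℤ) < ∑ j, s.2 j := by
      rw [← hωs, randomMass, sum_massRun_snd hz]
      have h1 : ∑ _j : V, (1 : ℤ) ≤ ∑ j, z₀ j := Finset.sum_le_sum fun j _ => hz j
      have h2 : 0 < Fintype.card V := Fintype.card_pos
      simp at h1
      omega
    have hr : rank B s < r + 1 := (hωs ▸ hAr ω hω.1).resolve_left hbal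
    obtain ⟨i, a, ha, t, hv⟩ := exists_piece_of_not_balanced hs hsum hbal
    obtain ⟨d, hd, hp⟩ := hG i t
    have h1 := pow_mul_measure_le_of_hasPath h hz hB (k := k) (A := A') (s := s)
      (MeasurableSet.inter hA (measurableSet_past_randomMass y₀ z₀ k {s}))
      (fun ω' hω' => hω'.2) hp ha hv
    refine (mul_le_mul_left (pow_le_pow_right_of_le_one' hq hd) _).trans (h1.trans ?_)
    refine measure_mono fun ω' hω' => ⟨hω'.1, Or.inr ?_⟩
    have h2 := (rank_massRun_le (y₀ := y₀) (z₀ := z₀) hz (fun k j i => X k j i ω')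
      (k := k + d) ((energy_massRun_le hz _ _).trans hB) (D - d)).1
    have h3 : k + d + (D - d) = k + D := by omega
    rw [h3] at h2
    have h4 : rank B (randomMass X y₀ z₀ (k + d) ω') < rank B s := hω'.2
    simp only [randomMass] at h4 ⊢
    omega

variable [IsProbabilityMeasure μ]

/-- Failure up to a given window is an event of the past, so the one-window bound applies on it and
the failure probabilities multiply. -/
theorem measureReal_inter_not_nearBalanced_le (h : IsRandomChoice G μ X) (hz : ∀ j, 0 < z₀ j)
    {B : ℤ} (hB : energy (fun j => 2 * y₀ j, fun j => 2 * z₀ j) ≤ B)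
    {D : ℕ} (hG : ∀ i j, ∃ d ≤ D, HasPath G d i j) {k : ℕ} {A : Set Ω} {r : ℤ}
    (hA : MeasurableSet[past X k] A)
    (hAr : ∀ ω ∈ A, NearBalanced B (r + 1) (randomMass X y₀ z₀ k ω)) (τ : ℕ) :
    μ.real (A ∩ {ω | ¬ NearBalanced B r (randomMass X y₀ z₀ (k + τ * D) ω)})
      ≤ (1 - minProb G ^ D) ^ τ * μ.real A := by
  have hp : 0 ≤ 1 - minProb G ^ D :=
    sub_nonneg.2 (pow_le_one₀ (minProb_pos G).le (minProb_le_one G))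
  induction τ with
  | zero => simpa using measureReal_mono Set.inter_subset_left
  | succ τ ih =>
    set A' := A ∩ {ω | ¬ NearBalanced B r (randomMass X y₀ z₀ (k + τ * D) ω)} with hA'
    have hA'm : MeasurableSet[past X (k + τ * D)] A' :=
      MeasurableSet.inter (past_mono (Nat.le_add_right _ _) _ hA)
        (measurableSet_past_randomMass y₀ z₀ (k + τ * D) {s | ¬ NearBalanced B r s})
    have h1 := pow_mul_measure_le_nearBalanced h hz hB hG (k := k + τ * D) (A := A') (r := r) hA'm
      fun ω hω => nearBalanced_massRun_add hz _ ((energy_massRun_le hz _ _).trans hB)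
        (hAr ω hω.1) _
    have h2 : minProb G ^ D * μ.real A' ≤ μ.real
        (A' ∩ {ω | NearBalanced B r (randomMass X y₀ z₀ (k + τ * D + D) ω)}) := by
      have := ENNReal.toReal_mono (measure_ne_top _ _) h1
      rwa [ENNReal.toReal_mul, ENNReal.toReal_pow, ENNReal.toReal_ofReal (minProb_pos G).le]
        at this
    have h3 := measureReal_inter_add_sdiff (μ := μ) (s := A')
      (measurableSet_randomMass h y₀ z₀ (k + τ * D + D) {s | NearBalanced B r s})
    have h4 : A ∩ {ω | ¬ NearBalanced B r (randomMass X y₀ z₀ (k + (τ + 1) * D) ω)}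
        ⊆ A' \ {ω | NearBalanced B r (randomMass X y₀ z₀ (k + τ * D + D) ω)} := by
      have h5 : k + (τ + 1) * D = k + τ * D + D := by ring
      rw [h5]
      refine fun ω hω => ⟨⟨hω.1, fun hn => hω.2 ?_⟩, hω.2⟩
      exact nearBalanced_massRun_add hz _ ((energy_massRun_le hz _ _).trans hB) hn _
    calc _ ≤ _ := measureReal_mono h4
      _ ≤ (1 - minProb G ^ D) * μ.real A' := by
          simp only [Set.mem_ofPred_eq] at h3
          linarith
      _ ≤ (1 - minProb G ^ D) * ((1 - minProb G ^ D) ^ τ * μ.real A) := by gcongr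
      _ = _ := by ring

/-- Induction over phases of τ windows: given success so far, each phase lowers the rank threshold
by one with probability at least `1 - (1 - minProb G ^ D) ^ τ`. -/
theorem pow_le_measureReal_nearBalanced (h : IsRandomChoice G μ X) (hz : ∀ j, 0 < z₀ j)
    {B : ℤ} (hB : energy (fun j => 2 * y₀ j, fun j => 2 * z₀ j) ≤ B)
    {D : ℕ} (hG : ∀ i j, ∃ d ≤ D, HasPath G d i j) {N : ℕ}
    (hN : rank B (fun j => 2 * y₀ j, fun j => 2 * z₀ j) < N) (τ n : ℕ) :
    (1 - (1 - minProb G ^ D) ^ τ) ^ n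
      ≤ μ.real {ω | NearBalanced B (N - n) (randomMass X y₀ z₀ (n * τ * D) ω)} := by
  have hp0 : 0 ≤ 1 - minProb G ^ D :=
    sub_nonneg.2 (pow_le_one₀ (minProb_pos G).le (minProb_le_one G))
  have hp1 : 1 - minProb G ^ D ≤ 1 := sub_le_self _ (pow_nonneg (minProb_pos G).le _)
  have hp2 : 0 ≤ 1 - (1 - minProb G ^ D) ^ τ := sub_nonneg.2 (pow_le_one₀ hp0 hp1)
  induction n with
  | zero =>
    have : {ω | NearBalanced B (N - (0 : ℕ)) (randomMass X y₀ z₀ (0 * τ * D) ω)} = Set.univ := by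
      refine Set.eq_univ_of_forall fun ω => Or.inr ?_
      simpa [randomMass, massRun] using hN
    rw [this]
    simp
  | succ n ih =>
    set A := {ω | NearBalanced B (N - n) (randomMass X y₀ z₀ (n * τ * D) ω)} with hA
    have h1 := measureReal_inter_not_nearBalanced_le h hz hB hG (k := n * τ * D) (A := A)
      (r := N - (n + 1 : ℕ))
      (measurableSet_past_randomMass y₀ z₀ (n * τ * D) {s | NearBalanced B (N - n) s})
      (fun ω hω => by
        have h0 : ((N : ℤ) - (n + 1 : ℕ)) + 1 = N - n := by push_cast; ring
        rw [h0]; exact hω) τ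
    have h2 := measureReal_inter_add_sdiff (μ := μ) (s := A)
      (measurableSet_randomMass h y₀ z₀ (n * τ * D + τ * D)
        {s | NearBalanced B (N - (n + 1 : ℕ)) s})
    have h3 : (n + 1) * τ * D = n * τ * D + τ * D := by ring
    rw [h3]
    have h4 : μ.real (A ∩ {ω | randomMass X y₀ z₀ (n * τ * D + τ * D) ω ∈
        {s | NearBalanced B (N - (n + 1 : ℕ)) s}}) ≤ μ.real {ω | NearBalanced B (N - (n + 1 : ℕ))
          (randomMass X y₀ z₀ (n * τ * D + τ * D) ω)} :=
      measureReal_mono Set.inter_subset_right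
    have h5 : μ.real (A \ {ω | randomMass X y₀ z₀ (n * τ * D + τ * D) ω ∈
        {s | NearBalanced B (N - (n + 1 : ℕ)) s}}) ≤ (1 - minProb G ^ D) ^ τ * μ.real A := h1
    calc (1 - (1 - minProb G ^ D) ^ τ) ^ (n + 1)
        = (1 - (1 - minProb G ^ D) ^ τ) * (1 - (1 - minProb G ^ D) ^ τ) ^ n := by ring
      _ ≤ (1 - (1 - minProb G ^ D) ^ τ) * μ.real A := by gcongr
      _ ≤ _ := by linarith

theorem pow_le_measureReal_balanced (h : IsRandomChoice G μ X) (hz : ∀ j, 0 < z₀ j)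
    {B : ℤ} (hB : energy (fun j => 2 * y₀ j, fun j => 2 * z₀ j) ≤ B)
    {D : ℕ} (hG : ∀ i j, ∃ d ≤ D, HasPath G d i j) {N : ℕ}
    (hN : rank B (fun j => 2 * y₀ j, fun j => 2 * z₀ j) < N) (τ : ℕ) :
    (1 - (1 - minProb G ^ D) ^ τ) ^ N
      ≤ μ.real {ω | Balanced (randomMass X y₀ z₀ (N * τ * D) ω)} := by
  refine (pow_le_measureReal_nearBalanced h hz hB hG hN τ N).trans
    (measureReal_mono fun ω hω => ?_)
  -- After N phases the threshold is 0, which no rank can undercut.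
  refine Or.resolve_right hω fun hr => ?_
  have := rank_nonneg (s := randomMass X y₀ z₀ (N * τ * D) ω)
    ((energy_massRun_le hz _ _).trans hB)
  omega

end Probability

end Descent

/-! ### The optimum, graph bounds and final assembly -/

theorem globalCost_xStar_lt {V : Type*} [Fintype V] [Nonempty V] {α : V → ℚ} (ρ : V → ℚ)
    (hα : ∀ j, 0 < α j) {x : ℚ} (hx : x ≠ xStar α ρ) :
    globalCost α ρ (xStar α ρ) < globalCost α ρ x := by
  have hS : 0 < ∑ i, α i := Finset.sum_pos (fun i _ => hα i) Finset.univ_nonempty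
  have h1 : xStar α ρ * ∑ i, α i = ∑ i, α i * ρ i := div_mul_cancel₀ _ hS.ne'
  have h2 : ∀ x, globalCost α ρ x
      = (1 / 2) * (x ^ 2 * ∑ i, α i) - x * ∑ i, α i * ρ i
        + (1 / 2) * ∑ i, α i * ρ i ^ 2 := by
    intro x
    simp only [globalCost, Finset.mul_sum, ← Finset.sum_sub_distrib, ← Finset.sum_add_distrib]
    exact Finset.sum_congr rfl fun i _ => by ring
  have h3 : globalCost α ρ x - globalCost α ρ (xStar α ρ)
      = (1 / 2) * ((x - xStar α ρ) ^ 2 * ∑ i, α i) := by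
    rw [h2, h2, ← h1]; ring
  have h4 : 0 < (x - xStar α ρ) ^ 2 := by
    have := sub_ne_zero.2 hx
    positivity
  have h5 : 0 < (1 / 2) * ((x - xStar α ρ) ^ 2 * ∑ i, α i) := by positivity
  linarith

theorem xStar_eq {V : Type*} [Fintype V] {α ρ : V → ℚ} {y₀ z₀ : V → ℤ}
    (hy : ∀ j, (y₀ j : ℚ) = α j * ρ j) (hz : ∀ j, (z₀ j : ℚ) = α j) :
    xStar α ρ = ((∑ j, y₀ j : ℤ) : ℚ) / ((∑ j, z₀ j : ℤ) : ℚ) := by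
  push_cast
  simp only [hy, hz, xStar]

theorem pos_of_exists_hasPath {V : Type*} [Nontrivial V] {G : Digraph V} {D : ℕ} (hG : ∀ i j, ∃ d ≤ D, HasPath G d i j) : 0 < D := by
  obtain ⟨i, j, hij⟩ := exists_pair_ne V
  obtain ⟨d, hd, hp⟩ := hG i j
  rcases d with _ | d
  · exact absurd hp.eq_of_zero hij
  · omega

section Digraph

variable {V : Type*} [Fintype V] {G : Digraph V}

theorem exists_hasPath_le (hG : StronglyConnected G) {D : ℕ} (hD : diameter G ≤ D) (i j : V) :
    ∃ d ≤ D, HasPath G d i j := by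
  have hne : {t : ℕ | HasPath G t i j}.Nonempty := by
    rcases eq_or_ne i j with rfl | h
    · exact ⟨0, fun _ => i, rfl, rfl, by simp⟩
    · exact hG i j h
  refine ⟨pathDist G i j, le_trans ?_ hD, Nat.sInf_mem hne⟩
  exact Finset.le_sup (f := fun e : V × V => pathDist G e.1 e.2) (Finset.mem_univ (i, j))

variable [Nontrivial V]

theorem maxOutDegree_pos {D : ℕ} (hG : ∀ i j, ∃ d ≤ D, HasPath G d i j) :
    0 < maxOutDegree G := by
  classical
  obtain ⟨i, j, hij⟩ := exists_pair_ne V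
  obtain ⟨d, hd, hp⟩ := hG i j
  rcases d with _ | d
  · exact absurd hp.eq_of_zero hij
  · obtain ⟨l, hl, -⟩ := hp.uncons
    have h1 : 0 < outDegree G i := by
      unfold outDegree
      exact Finset.card_pos.2 ⟨l, by simpa using hl⟩
    exact h1.trans_le (Finset.le_sup (f := fun j => outDegree G j) (Finset.mem_univ i))

/-- Two distinct nodes joined by a path force an out-degree of at least 1 and D > 0. This keeps the
argument of the logarithm in the time bound positive. -/
theorem minProb_pow_lt_one {D : ℕ} (hG : ∀ i j, ∃ d ≤ D, HasPath G d i j) :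
    minProb G ^ D < 1 := by
  refine pow_lt_one₀ (minProb_pos G).le ?_ (pos_of_exists_hasPath hG).ne'
  have : (0 : ℝ) < maxOutDegree G := by exact_mod_cast maxOutDegree_pos hG
  rw [minProb, div_lt_one (by positivity)]
  linarith

/-- Once the masses are balanced at the beginning of some window, all nodes terminate
simultaneously at the end of the first such window, and nothing changes any more. -/
theorem exists_termination {y₀ z₀ : V → ℤ} (hz : ∀ j, 0 < z₀ j) {X : ℕ → V → ℕ → V} {D : ℕ}
    (hG : ∀ i j, ∃ d ≤ D, HasPath G d i j) {w : ℕ} (hB : Balanced (massRun y₀ z₀ X (w * D))) :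
    ∃ K ≤ w * D + D, (∀ k < K, ∀ j, (run G D y₀ z₀ X k).flag j = false) ∧
      (∀ j, (run G D y₀ z₀ X K).flag j = true ∧ (run G D y₀ z₀ X K).qs j
        = ⌊((∑ j, y₀ j : ℤ) : ℚ) / ((∑ j, z₀ j : ℤ) : ℚ)⌋) ∧
      ∀ k ≥ K, run G D y₀ z₀ X k = run G D y₀ z₀ X K := by
  classical
  have hex : ∃ w, Balanced (massRun y₀ z₀ X (w * D)) := ⟨w, hB⟩
  obtain ⟨h1, h2⟩ := run_of_first_balanced (pos_of_exists_hasPath hG) hG hz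
    (fun w hw => Nat.find_min hex hw) (Nat.find_spec hex)
  refine ⟨(Nat.find hex + 1) * D, ?_, h1, h2, fun k hk => run_eq_of_flag (fun j => (h2 j).1) hk⟩
  calc (Nat.find hex + 1) * D ≤ (w + 1) * D := by gcongr; exact Nat.find_min' hex hB
    _ = w * D + D := by ring

theorem ae_exists_balanced {y₀ z₀ : V → ℤ} (hz : ∀ j, 0 < z₀ j) {D : ℕ}
    (hG : ∀ i j, ∃ d ≤ D, HasPath G d i j) {Ω : Type*} [MeasurableSpace Ω] {μ : Measure Ω}
    [IsProbabilityMeasure μ] {X : ℕ → V → ℕ → Ω → V} (h : IsRandomChoice G μ X) {B : ℤ}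
    (hB : energy (fun j => 2 * y₀ j, fun j => 2 * z₀ j) ≤ B) {N : ℕ}
    (hN : rank B (fun j => 2 * y₀ j, fun j => 2 * z₀ j) < N) :
    ∀ᵐ ω ∂μ, ∃ w, Balanced (randomMass X y₀ z₀ (w * D) ω) := by
  have hm : MeasurableSet {ω | ∃ w, Balanced (randomMass X y₀ z₀ (w * D) ω)} := by
    have : {ω | ∃ w, Balanced (randomMass X y₀ z₀ (w * D) ω)}
        = ⋃ w, {ω | randomMass X y₀ z₀ (w * D) ω ∈ {s | Balanced s}} := by
      ext ω; simp
    rw [this]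
    exact MeasurableSet.iUnion fun w => measurableSet_randomMass h y₀ z₀ (w * D) _
  have hlim : Filter.Tendsto (fun τ : ℕ => (1 - (1 - minProb G ^ D) ^ τ) ^ N) Filter.atTop
      (nhds ((1 - 0) ^ N)) :=
    ((tendsto_pow_atTop_nhds_zero_of_lt_one (sub_nonneg.2 (minProb_pow_lt_one hG).le)
      (sub_lt_self _ (pow_pos (minProb_pos G) D))).const_sub 1).pow N
  rw [sub_zero, one_pow] at hlim
  have h1 : 1 ≤ μ.real {ω | ∃ w, Balanced (randomMass X y₀ z₀ (w * D) ω)} := by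
    refine le_of_tendsto' hlim fun τ => ?_
    refine (pow_le_measureReal_balanced h hz hB hG hN τ).trans (measureReal_mono ?_)
    exact fun ω hω => ⟨N * τ, hω⟩
  have h2 : μ {ω | ∃ w, Balanced (randomMass X y₀ z₀ (w * D) ω)} = 1 := by
    refine le_antisymm prob_le_one ?_
    rw [measureReal_def] at h1
    simpa using ENNReal.ofReal_le_of_le_toReal h1
  exact (mem_ae_iff_prob_eq_one hm).2 h2

theorem pow_le_of_ceil_log_div_log_le {ε p : ℝ} (hε : 0 < ε) (hp0 : 0 < p) (hp1 : p < 1) {τ : ℕ}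
    (h : ⌈Real.log ε / Real.log p⌉ ≤ (τ : ℤ)) : p ^ τ ≤ ε := by
  have h1 : Real.log ε / Real.log p ≤ τ := by exact_mod_cast Int.ceil_le.1 h
  rw [div_le_iff_of_neg (Real.log_neg hp0 hp1), ← Real.log_pow] at h1
  exact (Real.log_le_log_iff (pow_pos hp0 _) hε).1 h1

end Digraph

end QuantizedOpt

end

theorem theorem1 {V : Type*} [Fintype V] [Nontrivial V]
    (α ρ : V → ℚ) (hα : ∀ j, 0 < α j)
    (y₀ z₀ : V → ℤ) (hy : ∀ j, (y₀ j : ℚ) = α j * ρ j) (hz : ∀ j, (z₀ j : ℚ) = α j) :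
    -- `xStar α ρ` is the unique optimum
    (∀ x : ℚ, x ≠ QuantizedOpt.xStar α ρ →
      QuantizedOpt.globalCost α ρ (QuantizedOpt.xStar α ρ) < QuantizedOpt.globalCost α ρ x) ∧
    ∃ N : ℕ, ∀ (G : Digraph V), (∀ v, ¬ G.Adj v v) → QuantizedOpt.StronglyConnected G →
      ∀ D : ℕ, QuantizedOpt.diameter G ≤ D →
      ∀ (Ω : Type*) [MeasurableSpace Ω] (μ : Measure Ω) [IsProbabilityMeasure μ]
        (X : ℕ → V → ℕ → Ω → V), QuantizedOpt.IsRandomChoice G μ X →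
      -- almost surely all nodes terminate, at the same finite step, with the quantized optimum
      (∀ᵐ ω ∂μ, ∃ K : ℕ,
        (∀ k < K, ∀ j,
          (QuantizedOpt.run G D y₀ z₀ (fun k j i => X k j i ω) k).flag j = false) ∧
        (∀ j, (QuantizedOpt.run G D y₀ z₀ (fun k j i => X k j i ω) K).flag j = true ∧
          (QuantizedOpt.run G D y₀ z₀ (fun k j i => X k j i ω) K).qs j
            = ⌊QuantizedOpt.xStar α ρ⌋ ∧
          |((QuantizedOpt.run G D y₀ z₀ (fun k j i => X k j i ω) K).qs j : ℚ)
            - QuantizedOpt.xStar α ρ| < 1) ∧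
        (∀ k ≥ K, QuantizedOpt.run G D y₀ z₀ (fun k j i => X k j i ω) k
            = QuantizedOpt.run G D y₀ z₀ (fun k j i => X k j i ω) K)) ∧
      -- a bound on the number of steps
      (∀ ε : ℝ, 0 < ε → ε < 1 → ∀ τ : ℕ,
        ⌈Real.log ε /
          Real.log (1 - ((1 + (QuantizedOpt.maxOutDegree G : ℝ)) ^ D)⁻¹)⌉ ≤ (τ : ℤ) →
        ENNReal.ofReal ((1 - ε) ^ N) ≤
          μ {ω | ∀ j,
            (QuantizedOpt.run G D y₀ z₀ (fun k j i => X k j i ω) (N * τ * D + D)).flag j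
              = true ∧
            (QuantizedOpt.run G D y₀ z₀ (fun k j i => X k j i ω) (N * τ * D + D)).qs j
              = ⌊QuantizedOpt.xStar α ρ⌋}) := by
  have hz0 : ∀ j, 0 < z₀ j := fun j => by
    have := hα j
    rw [← hz j] at this
    exact_mod_cast this
  refine ⟨fun x hx => QuantizedOpt.globalCost_xStar_lt ρ hα hx, ?_⟩
  set s₀ : (V → ℤ) × (V → ℤ) := (fun j => 2 * y₀ j, fun j => 2 * z₀ j) with hs₀
  set B := QuantizedOpt.energy s₀ with hB
  -- One more than the initial rank, so that the strict threshold holds before the first phase;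
  -- neither G nor D enters.
  refine ⟨(QuantizedOpt.rank B s₀).toNat + 1, fun G _ hG D hD Ω _ μ _ X hX => ?_⟩
  set N := (QuantizedOpt.rank B s₀).toNat + 1 with hN
  have hN' : QuantizedOpt.rank B s₀ < N := by omega
  have hpath := QuantizedOpt.exists_hasPath_le hG hD
  rw [QuantizedOpt.xStar_eq hy hz]
  constructor
  · filter_upwards [QuantizedOpt.ae_exists_balanced hz0 hpath hX hB.ge hN'] with ω hω
    obtain ⟨w, hw⟩ := hω
    obtain ⟨K, -, h1, h2, h3⟩ := QuantizedOpt.exists_termination hz0 hpath hw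
    refine ⟨K, h1, fun j => ⟨(h2 j).1, (h2 j).2, ?_⟩, h3⟩
    rw [(h2 j).2, abs_sub_lt_iff]
    constructor
    · linarith [Int.floor_le (((∑ j, y₀ j : ℤ) : ℚ) / ((∑ j, z₀ j : ℤ) : ℚ))]
    · linarith [Int.lt_floor_add_one (((∑ j, y₀ j : ℤ) : ℚ) / ((∑ j, z₀ j : ℤ) : ℚ))]
  · intro ε hε0 hε1 τ hτ
    have hp : ((1 + (QuantizedOpt.maxOutDegree G : ℝ)) ^ D)⁻¹ = QuantizedOpt.minProb G ^ D := by
      rw [QuantizedOpt.minProb, one_div, inv_pow]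
    rw [hp] at hτ
    have h1 := QuantizedOpt.pow_le_of_ceil_log_div_log_le hε0
      (sub_pos.2 (QuantizedOpt.minProb_pow_lt_one hpath))
      (sub_lt_self _ (pow_pos (QuantizedOpt.minProb_pos G) D)) hτ
    have h2 : (1 - ε) ^ N ≤ μ.real {ω | QuantizedOpt.Balanced
        (QuantizedOpt.randomMass X y₀ z₀ (N * τ * D) ω)} :=
      (pow_le_pow_left₀ (sub_nonneg.2 hε1.le) (sub_le_sub_left h1 1) N).trans
        (QuantizedOpt.pow_le_measureReal_balanced hX hz0 hB.ge hpath hN' τ)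
    refine (ENNReal.ofReal_le_of_le_toReal h2).trans (measure_mono fun ω hω j => ?_)
    obtain ⟨K, hK, -, h3, h4⟩ := QuantizedOpt.exists_termination hz0 hpath hω
    rw [h4 _ hK]
    exact h3 j
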